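/- A computable ring is a ring whose underlying set is a computable set $A\subseteq\mathbb{N}$ such that $+$ and $\cdot$ are computable functions from $A\times A$ to $A$. A strongly computable finite factorization domain (SCFFD) is a computable integral domain $A$ equipped with a computable function $D$ such that, for every $a\in A\setminus\{0\}$, $D(a)$ is a canonical index for the finite set of divisors of $a$ in $A$ (so in particular every nonzero element has only finitely many divisors). $U(R)$ denotes the set of units of a ring $R$. Theorem. Let $A$ be an SCFFD and let $q\in A$ be prime. Let $F$ be the field of fractions of $A$ and let $B$ be the subring of $F[x]$ consisting of those polynomials of the form $$a_0+a_1x+\frac{a_2}{q^2}x^2+\frac{a_3}{q^3}x^3+\dots+\frac{a_n}{q^n}x^n$$ where each $a_i\in A$. Then: 1. For every nonzero $a\in A$, the set of divisors of $a$ in $A$ equals the set of divisors of $a$ in $B$. 2. $B$ is an SCFFD. Moreover, given (indices for) $A$, the element $q$, and an index for a function $D$ witnessing that $A$ is an SCFFD, we can computably build $B$ as an extension of $A$ (after a fixed computable renaming of the natural numbers coding the elements of $A$) and obtain an index for a function $D'$ witnessing that $B$ is an SCFFD, with the property that $D'(a)=D(a)$ for all $a\in A$ (with the elements of the finite sets renamed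 in the same way). 3. $U(B)=U(A)$. 4. If $p$ is irreducible in $A$, then $p$ is irreducible in $B$. 5. If $p_1,p_2\in A$ are irreducibles that are not associates in $A$, then they are not associates in $B$. 6. $q$ is not prime in $B$. 7. If $p$ is a prime of $A$ that is not an associate of $q$, then $p$ is prime in $B$. -/

import Mathlib

open Polynomial

open Nat.Partrec (Code)

universe u v

/-- The canonical index `∑_{n ∈ S} 2 ^ n` of a finite set `S` of natural numbers. -/
def canonicalIndex (S : Finset ℕ) : ℕ := ∑ n ∈ S, 2 ^ n

/-- The finite set of natural numbers with canonical index `u`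
(the positions of the digit 1 in the binary expansion of `u`). -/
def canonicalSet (u : ℕ) : Finset ℕ := u.bitIndices.toFinset

theorem canonicalIndex_canonicalSet (u : ℕ) : canonicalIndex (canonicalSet u) = u := by
  unfold canonicalIndex canonicalSet
  exact Finset.equivBitIndices.symm_apply_apply u

theorem canonicalSet_canonicalIndex (S : Finset ℕ) : canonicalSet (canonicalIndex S) = S := by
  unfold canonicalIndex canonicalSet
  exact Finset.equivBitIndices.apply_symm_apply S

/-- The operation on canonical indices that corresponds to replacing a finite set `S` by its
image `ι '' S`. -/
def canonicalRelabel (ι : ℕ → ℕ) (u : ℕ) : ℕ := canonicalIndex ((canonicalSet u).image ι)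

/-- Indices (programs) for the data of a computable ring: a program for the characteristic function
of the underlying set, a program for addition, and a program for multiplication.
Pairs of natural numbers are passed to programs through `Nat.pair`. -/
abbrev RingIndex : Type := Code × Code × Code

/-- Indices for the data of a strongly computable finite factorization domain: those of a
computable ring, and a program for the divisor function. -/
abbrev SCFFDIndex : Type := RingIndex × Code

/-- `code` identifies the ring `A` with a set of natural numbers, and `e` is a triple of indices
witnessing that this makes `A` a computable ring: the set is computable and the operations are
computable functions on it. -/
structure IsComputableRing {A : Type u} [CommRing A] (code : A ↪ ℕ) (e : RingIndex) : Prop where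
  eval_mem : ∀ n ∈ Set.range code, e.1.eval n = Part.some 1
  eval_notMem : ∀ n ∉ Set.range code, e.1.eval n = Part.some 0
  eval_add : ∀ a b : A, e.2.1.eval (Nat.pair (code a) (code b)) = Part.some (code (a + b))
  eval_mul : ∀ a b : A, e.2.2.eval (Nat.pair (code a) (code b)) = Part.some (code (a * b))

/-- `code` identifies the integral domain `A` with a set of natural numbers, and the indices `e`
witness that this makes `A` a strongly computable finite factorization domain: `A` is a computable
ring, every nonzero `a` has finitely many divisors, and the last index computes, from (the code of)
a nonzero `a`, the canonical index of the finite set of (the codes of) all divisors of `a`. -/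
structure IsSCFFD {A : Type u} [CommRing A] [IsDomain A] (code : A ↪ ℕ) (e : SCFFDIndex) :
    Prop where
  isComputableRing : IsComputableRing code e.1
  eval_divisors : ∀ a : A, a ≠ 0 → ∃ S : Finset A, (∀ b : A, b ∈ S ↔ b ∣ a) ∧
    e.2.eval (code a) = Part.some (canonicalIndex (S.map code))

/-- The exponent of `q` in the denominator of the coefficient of `x ^ i`:
it is `0` for `i = 0, 1`, and `i` for `i ≥ 2`. -/
def denomExp (i : ℕ) : ℕ := if i < 2 then 0 else i

theorem denomExp_add_le (i j : ℕ) : denomExp i + denomExp j ≤ denomExp (i + j) := by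
  unfold denomExp; split_ifs <;> omega

section

variable {A : Type u} [CommRing A] [IsDomain A] (F : Type v) [Field F] [Algebra A F]

/-- The fraction `a / q ^ (denomExp i)` in `F`. -/
def denomFrac (q : A) (i : ℕ) (a : A) : F := algebraMap A F a / algebraMap A F q ^ denomExp i

variable [IsFractionRing A F]

/-- The subring of `F[x]` of all polynomials
`a₀ + a₁ x + (a₂ / q²) x² + (a₃ / q³) x³ + ⋯ + (aₙ / qⁿ) xⁿ` with all `aᵢ ∈ A`, where `F` is the
field of fractions of `A` and `q` is a prime of `A`. -/
def primeDestroyer {q : A} (hq : Prime q) : Subring F[X] where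
  carrier := {f | ∀ i, ∃ a : A, f.coeff i = denomFrac F q i a}
  zero_mem' i := ⟨0, by simp [denomFrac]⟩
  one_mem' i := by
    rcases Nat.eq_zero_or_pos i with rfl | hi
    · exact ⟨1, by simp [denomFrac, denomExp]⟩
    · exact ⟨0, by simp [denomFrac, coeff_one, hi.ne']⟩
  add_mem' {f g} hf hg i := by
    obtain ⟨a, ha⟩ := hf i
    obtain ⟨b, hb⟩ := hg i
    exact ⟨a + b, by simp [denomFrac, ha, hb, add_div]⟩
  neg_mem' {f} hf i := by
    obtain ⟨a, ha⟩ := hf i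
    exact ⟨-a, by simp [denomFrac, ha, neg_div]⟩
  mul_mem' {f g} hf hg i := by
    have hq' : algebraMap A F q ≠ 0 := by
      simpa using (IsFractionRing.injective A F).ne hq.ne_zero
    rw [coeff_mul]
    refine Finset.sum_induction _ (fun z => ∃ a : A, z = denomFrac F q i a) ?_ ?_ ?_
    · rintro _ _ ⟨a, rfl⟩ ⟨b, rfl⟩
      exact ⟨a + b, by simp [denomFrac, add_div]⟩
    · exact ⟨0, by simp [denomFrac]⟩
    · rintro ⟨k, l⟩ hkl
      obtain rfl : k + l = i := by simpa using hkl
      obtain ⟨a, ha⟩ := hf k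
      obtain ⟨b, hb⟩ := hg l
      obtain ⟨d, hd⟩ := Nat.exists_eq_add_of_le (denomExp_add_le k l)
      refine ⟨a * b * q ^ d, ?_⟩
      simp only [ha, hb, denomFrac, hd, map_mul, map_pow, pow_add]
      field_simp

/-- The inclusion of `A` in the subring `primeDestroyer F hq` of `F[x]`
as the constant polynomials. -/
noncomputable def primeDestroyerIncl {q : A} (hq : Prime q) : A →+* primeDestroyer F hq :=
  (C.comp (algebraMap A F)).codRestrict (primeDestroyer F hq) fun a i => by
    rcases Nat.eq_zero_or_pos i with rfl | hi
    · exact ⟨a, by simp [denomFrac, denomExp]⟩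
    · exact ⟨0, by simp [denomFrac, coeff_C, hi.ne']⟩

end

/-!
The substitution `x ↦ q x` turns an element of `B` into a polynomial over `A`, and identifies `B`
with the ring of all `P ∈ A[X]` whose coefficient of `X` is divisible by `q` (`toPoly`,
`exists_toPoly_eq`). Everything is proved for such polynomials.

*Algebra.* Degrees add, so the divisors in `B` of a nonzero constant are constants
(`dvd_incl_iff`); this gives the statements on divisors, units, irreducibles and associates. A
prime `p` of `A` that is not an associate of `q` divides an element of `B` exactly if it divides
the corresponding polynomial in `A[X]`, where `p` is prime (`prime_incl`). In `B` the element `q`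
divides `x ^ 2` but not `x` (`not_prime_incl`).

*Divisors of a nonconstant polynomial* are found by Kronecker's method. If `Q` divides `P ≠ 0` in
`A[X]` and `deg P ≤ n`, then among the `2 n + 1` distinct elements `1, q, …, q ^ (2 n)` there are
`n + 1` nonroots of `P`. At each of them the value of `Q` is one of the finitely many divisors of
the value of `P`, and `Q` is recovered from these values by Newton interpolation, whose divided
differences are again divisors of elements found before. So every coefficient of `Q` is obtained
from `q` and the coefficients of `P` by a bounded number of rounds of adding, multiplying and
passing to divisors (`coeff_mem_reach_of_dvd`). Each round is a computation with finite lists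
(`exists_closeIter_eq`), which yields a finite list of candidates, and the candidates are tested
by multiplying them in pairs (`exists_divNonconst_eq`).

*Coding.* Constants get the code `2 * code a`, all other polynomials an odd number that encodes
the list of their coefficients up to the degree (`codeP`); thus the renaming is `n ↦ 2 n`. The
programs are partial recursive functions of the indices of `A`, of the code of `q`, and of the
input; the s-m-n theorem then computes the indices of `B` (`exists_index_transform`). The code of
`0`, which they need, is found by a search (`findZero_eq`).
-/

/-! ### The ring `B` as a subring of `A[X]` -/

section

theorem exists_coeff_eq {A : Type u} [Semiring A] (a : ℕ → A) {N : ℕ} (h : ∀ i, N ≤ i → a i = 0) :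
    ∃ P : A[X], ∀ i, P.coeff i = a i := by
  refine ⟨∑ i ∈ Finset.range N, monomial i (a i), fun i => ?_⟩
  simp only [finsetSum_coeff, coeff_monomial, Finset.sum_ite_eq', Finset.mem_range]
  split_ifs with hi
  · rfl
  · exact (h i (not_lt.1 hi)).symm

variable {A : Type u} [CommRing A] (F : Type v) [Field F] [Algebra A F]

/-- The substitution `X ↦ X / q`, as a ring homomorphism `A[X] → F[X]`: it divides the `i`-th
coefficient by `q ^ i`. -/
noncomputable def descale (q : A) : A[X] →+* F[X] :=
  eval₂RingHom (C.comp (algebraMap A F)) (C (algebraMap A F q)⁻¹ * X)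

theorem coeff_descale (q : A) (P : A[X]) (i : ℕ) :
    (descale F q P).coeff i = algebraMap A F (P.coeff i) / algebraMap A F q ^ i := by
  induction P using Polynomial.induction_on' with
  | add P Q hP hQ => simp [hP, hQ, add_div]
  | monomial n a =>
    simp only [descale, coe_eval₂RingHom, eval₂_monomial, RingHom.comp_apply, mul_pow, ← C_pow,
      ← mul_assoc, ← C_mul, coeff_C_mul, coeff_X_pow, coeff_monomial]
    split_ifs with h h' h'
    · subst h; simp [div_eq_mul_inv]
    · exact absurd h.symm h'
    · exact absurd h'.symm h
    · simp

theorem descale_C (q a : A) : descale F q (C a) = C (algebraMap A F a) := by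
  simp [descale]

variable [IsDomain A] [IsFractionRing A F] {q : A} (hq : Prime q)

theorem descale_injective (hq : Prime q) : Function.Injective (descale F q) := by
  intro P Q h
  ext i
  have h0 : algebraMap A F q ≠ 0 := by simpa using (IsFractionRing.injective A F).ne hq.ne_zero
  have := congrArg (fun f => coeff f i) h
  simp only [coeff_descale] at this
  rw [div_left_inj' (pow_ne_zero _ h0)] at this
  exact IsFractionRing.injective A F this

theorem descale_mem {P : A[X]} (hP : q ∣ P.coeff 1) : descale F q P ∈ primeDestroyer F hq := by
  have h0 : algebraMap A F q ≠ 0 := by simpa using (IsFractionRing.injective A F).ne hq.ne_zero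
  intro i
  rw [coeff_descale]
  by_cases hi : i = 1
  · obtain ⟨c, hc⟩ := hP
    exact ⟨c, by subst hi; simp [hc, denomFrac, denomExp, h0]⟩
  · refine ⟨P.coeff i, ?_⟩
    rcases Nat.lt_or_ge i 2 with h | h
    · obtain rfl : i = 0 := by omega
      simp [denomFrac, denomExp]
    · simp [denomFrac, denomExp, h.not_gt]

/-- An element of `B` with coefficients `aᵢ / q ^ denomExp i` becomes, after `x ↦ q x`, the
polynomial with coefficients `aᵢ` for `i ≠ 1` and `q a₁` for `i = 1`. -/
theorem descale_eq_of_coeff {f : F[X]} {P : A[X]} {a : ℕ → A}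
    (hf : ∀ i, f.coeff i = denomFrac F q i (a i))
    (hP : ∀ i, P.coeff i = if i = 1 then q * a i else a i) (hq : Prime q) : descale F q P = f := by
  have h0 : algebraMap A F q ≠ 0 := by simpa using (IsFractionRing.injective A F).ne hq.ne_zero
  ext i
  rw [coeff_descale, hf, hP]
  split_ifs with h
  · subst h; simp [denomFrac, denomExp, h0]
  · rcases Nat.lt_or_ge i 2 with h | h
    · obtain rfl : i = 0 := by omega
      simp [denomFrac, denomExp]
    · simp [denomFrac, denomExp, h.not_gt]

theorem exists_descale_eq (f : primeDestroyer F hq) :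
    ∃ P : A[X], q ∣ P.coeff 1 ∧ descale F q P = f := by
  choose a ha using f.2
  have h0 : algebraMap A F q ≠ 0 := by simpa using (IsFractionRing.injective A F).ne hq.ne_zero
  have hz : ∀ i, (f : F[X]).natDegree < i → a i = 0 := by
    intro i hi
    have := ha i
    rw [coeff_eq_zero_of_natDegree_lt hi, denomFrac, eq_comm, div_eq_zero_iff] at this
    exact (IsFractionRing.injective A F) (by simpa [h0] using this)
  obtain ⟨P, hP⟩ := exists_coeff_eq (fun i => if i = 1 then q * a i else a i)
    (N := (f : F[X]).natDegree + 1) (fun i hi => by simp [hz i hi])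
  exact ⟨P, by simp [hP], descale_eq_of_coeff F ha hP hq⟩

/-- The polynomial `f(q x)`, which has coefficients in `A`, for `f` in `B`. -/
noncomputable def toPoly (f : primeDestroyer F hq) : A[X] := (exists_descale_eq F hq f).choose

theorem dvd_coeff_toPoly (f : primeDestroyer F hq) : q ∣ (toPoly F hq f).coeff 1 :=
  (exists_descale_eq F hq f).choose_spec.1

theorem descale_toPoly (f : primeDestroyer F hq) : descale F q (toPoly F hq f) = f :=
  (exists_descale_eq F hq f).choose_spec.2

variable {F hq}

theorem toPoly_eq {f : primeDestroyer F hq} {P : A[X]} (h : descale F q P = f) :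
    toPoly F hq f = P :=
  descale_injective F hq ((descale_toPoly F hq f).trans h.symm)

theorem toPoly_injective : Function.Injective (toPoly F hq) := fun f g h =>
  Subtype.ext (by rw [← descale_toPoly F hq f, h, descale_toPoly])

theorem toPoly_add (f g : primeDestroyer F hq) :
    toPoly F hq (f + g) = toPoly F hq f + toPoly F hq g :=
  toPoly_eq (by simp [descale_toPoly])

theorem toPoly_mul (f g : primeDestroyer F hq) :
    toPoly F hq (f * g) = toPoly F hq f * toPoly F hq g :=
  toPoly_eq (by simp [descale_toPoly])

theorem toPoly_incl (a : A) : toPoly F hq (primeDestroyerIncl F hq a) = C a :=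
  toPoly_eq (by rw [descale_C]; rfl)

theorem exists_toPoly_eq {P : A[X]} (hP : q ∣ P.coeff 1) :
    ∃ f : primeDestroyer F hq, toPoly F hq f = P :=
  ⟨⟨_, descale_mem F hq hP⟩, toPoly_eq rfl⟩

theorem incl_injective : Function.Injective (primeDestroyerIncl F hq) := fun a b h =>
  C_injective (by rw [← toPoly_incl (F := F) (hq := hq), h, toPoly_incl])

theorem toPoly_ne_zero {f : primeDestroyer F hq} (hf : f ≠ 0) : toPoly F hq f ≠ 0 := fun h =>
  hf (toPoly_injective (h.trans (toPoly_eq (by simp)).symm))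

theorem natDegree_toPoly_eq_zero {f : primeDestroyer F hq} (h : (toPoly F hq f).natDegree = 0) :
    f = primeDestroyerIncl F hq ((toPoly F hq f).coeff 0) :=
  toPoly_injective ((eq_C_of_natDegree_eq_zero h).trans (toPoly_incl _).symm)

/-! ### Divisibility, units and primes in `B` -/

/-- The divisors in `B` of a nonzero constant are constant, since degrees add. -/
theorem dvd_incl_iff {a : A} (ha : a ≠ 0) (f : primeDestroyer F hq) :
    f ∣ primeDestroyerIncl F hq a ↔ ∃ b, b ∣ a ∧ primeDestroyerIncl F hq b = f := by
  constructor
  · rintro ⟨g, hg⟩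
    have h := congrArg (toPoly F hq) hg
    rw [toPoly_incl, toPoly_mul] at h
    have hne : toPoly F hq f * toPoly F hq g ≠ 0 := by rw [← h]; simpa using ha
    have hd := congrArg natDegree h
    rw [natDegree_C, natDegree_mul (left_ne_zero_of_mul hne) (right_ne_zero_of_mul hne)] at hd
    refine ⟨(toPoly F hq f).coeff 0, ⟨(toPoly F hq g).coeff 0, ?_⟩,
      (natDegree_toPoly_eq_zero (by omega)).symm⟩
    simpa [mul_coeff_zero] using congrArg (fun P => coeff P 0) h
  · rintro ⟨b, hb, rfl⟩
    exact map_dvd _ hb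

theorem incl_dvd_incl {a b : A} :
    primeDestroyerIncl F hq a ∣ primeDestroyerIncl F hq b ↔ a ∣ b := by
  refine ⟨fun ⟨g, hg⟩ => ?_, fun h => map_dvd _ h⟩
  have h := congrArg (fun f => (toPoly F hq f).coeff 0) hg
  simp only [toPoly_incl, toPoly_mul, mul_coeff_zero, coeff_C_zero] at h
  exact ⟨_, h⟩

theorem isUnit_iff_incl (f : primeDestroyer F hq) :
    IsUnit f ↔ ∃ a, IsUnit a ∧ primeDestroyerIncl F hq a = f := by
  simpa only [isUnit_iff_dvd_one, map_one] using dvd_incl_iff (F := F) (hq := hq) one_ne_zero f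

theorem isUnit_incl {a : A} : IsUnit (primeDestroyerIncl F hq a) ↔ IsUnit a := by
  rw [isUnit_iff_incl]
  exact ⟨fun ⟨b, hb, h⟩ => incl_injective h ▸ hb, fun h => ⟨a, h, rfl⟩⟩

theorem irreducible_incl {p : A} (hp : Irreducible p) :
    Irreducible (primeDestroyerIncl F hq p) := by
  refine ⟨fun h => hp.not_isUnit (isUnit_incl.1 h), fun f g h => ?_⟩
  obtain ⟨a, -, rfl⟩ := (dvd_incl_iff hp.ne_zero f).1 ⟨g, h⟩
  obtain ⟨b, -, rfl⟩ := (dvd_incl_iff hp.ne_zero g).1 ⟨_, h.trans (mul_comm _ _)⟩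
  rw [isUnit_incl, isUnit_incl]
  exact hp.isUnit_or_isUnit (incl_injective (by rw [h, map_mul]))

theorem associated_incl {a b : A} (h : Associated (primeDestroyerIncl F hq a)
    (primeDestroyerIncl F hq b)) : Associated a b :=
  associated_of_dvd_dvd (incl_dvd_incl.1 h.dvd) (incl_dvd_incl.1 h.symm.dvd)

theorem incl_dvd_iff {p : A} (hp : Prime p) (hpq : ¬ p ∣ q) (f : primeDestroyer F hq) :
    primeDestroyerIncl F hq p ∣ f ↔ C p ∣ toPoly F hq f := by
  constructor
  · rintro ⟨g, rfl⟩
    rw [toPoly_mul, toPoly_incl]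
    exact dvd_mul_right _ _
  · rintro ⟨P, hP⟩
    have h1 : q ∣ P.coeff 1 := by
      have h := dvd_coeff_toPoly F hq f
      rw [hP, coeff_C_mul] at h
      refine (hq.dvd_or_dvd h).resolve_left fun h' => hpq ?_
      -- a prime `q` dividing the prime `p` is an associate of it
      exact hq.irreducible.dvd_symm hp.irreducible h'
    obtain ⟨g, rfl⟩ := exists_toPoly_eq (F := F) (hq := hq) h1
    exact ⟨g, toPoly_injective (by rw [hP, toPoly_mul, toPoly_incl])⟩

theorem prime_incl {p : A} (hp : Prime p) (hpq : ¬ Associated p q) :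
    Prime (primeDestroyerIncl F hq p) := by
  have h : ¬ p ∣ q := fun h => hpq (hp.irreducible.associated_of_dvd hq.irreducible h)
  refine ⟨by simpa using (incl_injective (F := F) (hq := hq)).ne hp.ne_zero,
    fun hu => hp.not_isUnit (isUnit_incl.1 hu), fun f g hfg => ?_⟩
  rw [incl_dvd_iff hp h, toPoly_mul] at hfg
  rw [incl_dvd_iff hp h, incl_dvd_iff hp h]
  exact ((prime_C_iff.2 hp).dvd_or_dvd hfg)

/-- In `B` the element `q` divides `x ^ 2 = q ^ 2 * (x ^ 2 / q ^ 2)` but not `x`. -/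
theorem not_prime_incl : ¬ Prime (primeDestroyerIncl F hq q) := by
  intro h
  -- the elements `x` and `x ^ 2 / q` of `B`
  obtain ⟨f, hf⟩ := exists_toPoly_eq (F := F) (hq := hq) (P := C q * X) (by simp)
  obtain ⟨g, hg⟩ := exists_toPoly_eq (F := F) (hq := hq) (P := C q * X ^ 2) (by simp [coeff_X_pow])
  have hfg : f * f = primeDestroyerIncl F hq q * g :=
    toPoly_injective (by rw [toPoly_mul, toPoly_mul, toPoly_incl, hf, hg]; ring)
  obtain ⟨k, hk⟩ := or_self_iff.1 (h.dvd_or_dvd ⟨g, hfg⟩)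
  have h1 := congrArg (fun f => (toPoly F hq f).coeff 1) hk
  simp only [toPoly_mul, toPoly_incl, hf, coeff_C_mul, coeff_X_one] at h1
  refine hq.not_isUnit (isUnit_of_dvd_one ?_)
  rw [mul_left_cancel₀ hq.ne_zero h1]
  exact dvd_coeff_toPoly F hq k

/-- Divisibility in `B` expressed in `A[X]`. -/
theorem dvd_iff_toPoly (f g : primeDestroyer F hq) :
    f ∣ g ↔ ∃ h : primeDestroyer F hq, toPoly F hq f * toPoly F hq h = toPoly F hq g := by
  constructor
  · rintro ⟨h, rfl⟩
    exact ⟨h, (toPoly_mul _ _).symm⟩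
  · rintro ⟨h, hh⟩
    exact ⟨h, toPoly_injective (by rw [← hh, toPoly_mul])⟩

end

/-! ### Bounding the coefficients of a divisor -/

section

variable {A : Type u} [CommRing A]

/-- The elements obtained from `S` in `t` rounds, each of which adjoins all sums, products, and
divisors of nonzero elements. -/
def Reach (S : Set A) : ℕ → Set A
  | 0 => S
  | t + 1 => {x | x ∈ Reach S t ∨ (∃ a ∈ Reach S t, ∃ b ∈ Reach S t, x = a + b ∨ x = a * b) ∨
      ∃ a ∈ Reach S t, a ≠ 0 ∧ x ∣ a}

variable {S : Set A} {s t : ℕ} {a b : A}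

theorem reach_mono (h : s ≤ t) : Reach S s ⊆ Reach S t := by
  induction h with
  | refl => exact subset_rfl
  | step _ ih => exact fun x hx => Or.inl (ih hx)

theorem add_mem_reach (ha : a ∈ Reach S t) (hb : b ∈ Reach S t) : a + b ∈ Reach S (t + 1) :=
  Or.inr (Or.inl ⟨a, ha, b, hb, Or.inl rfl⟩)

theorem mul_mem_reach (ha : a ∈ Reach S t) (hb : b ∈ Reach S t) : a * b ∈ Reach S (t + 1) :=
  Or.inr (Or.inl ⟨a, ha, b, hb, Or.inr rfl⟩)

theorem dvd_mem_reach (ha : a ∈ Reach S t) (h0 : a ≠ 0) (h : b ∣ a) : b ∈ Reach S (t + 1) :=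
  Or.inr (Or.inr ⟨a, ha, h0, h⟩)

theorem sub_mem_reach (hn : (-1 : A) ∈ Reach S t) (ha : a ∈ Reach S t) (hb : b ∈ Reach S t) :
    a - b ∈ Reach S (t + 2) := by
  have := add_mem_reach (reach_mono t.le_succ ha) (mul_mem_reach hn hb)
  rwa [neg_one_mul, ← sub_eq_add_neg] at this

/-- Horner's scheme stays within two rounds per degree. -/
theorem eval_mem_reach {c : A} (hc : c ∈ Reach S s) (n : ℕ) (P : A[X]) (hd : P.natDegree ≤ n)
    (hP : ∀ i, P.coeff i ∈ Reach S s) : P.eval c ∈ Reach S (s + 2 * n) := by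
  induction n generalizing P with
  | zero =>
    rw [eq_C_of_natDegree_le_zero hd, eval_C]
    exact hP 0
  | succ n ih =>
    have h1 := ih P.divX (by rw [natDegree_divX_eq_natDegree_tsub_one]; omega)
      (fun i => by rw [coeff_divX]; exact hP _)
    have h2 := add_mem_reach (mul_mem_reach h1 (reach_mono (by omega) hc))
      (reach_mono (by omega) (hP 0))
    have h3 : P.eval c = P.divX.eval c * c + P.coeff 0 := by
      conv_lhs => rw [← divX_mul_X_add P]
      simp
    rwa [← h3] at h2

variable [IsDomain A]

/-- Newton interpolation: a polynomial of degree at most `n` is recovered from `n + 1` of its values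
through divided differences, where dividing means passing to a divisor. Each degree
costs three rounds for a divided difference and three for multiplying by `X - c₀` and adding the
value at `c₀`. -/
theorem coeff_mem_reach_of_eval (n : ℕ) : ∀ (s : ℕ) (I : Finset A) (P : A[X]), P.natDegree ≤ n →
    I.card = n + 1 → (0 : A) ∈ Reach S s → (-1 : A) ∈ Reach S s → (∀ c ∈ I, c ∈ Reach S s) →
    (∀ c ∈ I, P.eval c ∈ Reach S s) → ∀ i, P.coeff i ∈ Reach S (s + 6 * n) := by
  classical
  induction n with
  | zero =>
    intro s I P hd hI h0 _ _ hP i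
    obtain ⟨c, hc⟩ := Finset.card_pos.1 (by omega : 0 < I.card)
    have h := hP c hc
    rw [eq_C_of_natDegree_le_zero hd] at h ⊢
    rw [coeff_C]
    split_ifs
    · simpa using h
    · exact h0
  | succ n ih =>
    intro s I P hd hI h0 hn hc hP i
    obtain ⟨c₀, hc₀⟩ := Finset.card_pos.1 (by omega : 0 < I.card)
    set Q := P /ₘ (X - C c₀) with hQ
    have hPQ : P = C (P.eval c₀) + (X - C c₀) * Q := by
      conv_lhs => rw [← modByMonic_add_div P (X - C c₀), modByMonic_X_sub_C_eq_C_eval]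
    have hdQ : Q.natDegree ≤ n := by
      rw [hQ, natDegree_divByMonic _ (monic_X_sub_C c₀), natDegree_X_sub_C]; omega
    have hQc : ∀ c ∈ I.erase c₀, Q.eval c ∈ Reach S (s + 3) := by
      intro c hcI
      obtain ⟨hne, hcI⟩ := Finset.mem_erase.1 hcI
      have he : P.eval c - P.eval c₀ = (c - c₀) * Q.eval c := by
        conv_lhs => enter [1]; rw [hPQ]
        simp
      have hm := sub_mem_reach hn (hP c hcI) (hP c₀ hc₀)
      by_cases hz : P.eval c - P.eval c₀ = 0
      · rw [hz, eq_comm, mul_eq_zero, or_iff_right (sub_ne_zero.2 hne)] at he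
        rw [he]; exact reach_mono (by omega) h0
      · exact dvd_mem_reach hm hz (he ▸ dvd_mul_left _ _)
    have hQi := ih (s + 3) (I.erase c₀) Q hdQ (by rw [Finset.card_erase_of_mem hc₀]; omega)
      (reach_mono (by omega) h0) (reach_mono (by omega) hn)
      (fun c h => reach_mono (by omega) (hc c (Finset.mem_of_mem_erase h))) hQc
    have hm : ∀ x ∈ Reach S (s + 3 + 6 * n), ∀ j, x - c₀ * Q.coeff j ∈ Reach S (s + 6 * (n + 1)) :=
      fun x hx j => reach_mono (by omega) (sub_mem_reach (t := s + 3 + 6 * n + 1)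
        (reach_mono (by omega) hn) (reach_mono (by omega) hx)
        (mul_mem_reach (reach_mono (by omega) (hc c₀ hc₀)) (hQi j)))
    rw [hPQ]
    rcases i with _ | i
    · have := hm _ (reach_mono (by omega) (hP c₀ hc₀)) 0
      simpa [sub_mul, mul_coeff_zero, ← sub_eq_add_neg] using this
    · have := hm _ (hQi i) (i + 1)
      simpa [sub_mul, coeff_X_mul, coeff_C_succ] using this

/-- A prime has pairwise distinct powers, so one of them is a nonroot of a nonzero polynomial, and
there are as many such powers as wanted. -/
theorem exists_powers_eval_ne_zero {q : A} (hq : Prime q) {P : A[X]} (hP : P ≠ 0) {n : ℕ}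
    (hn : P.natDegree ≤ n) :
    ∃ I : Finset A, I.card = n + 1 ∧ ∀ c ∈ I, (∃ i ≤ 2 * n, c = q ^ i) ∧ P.eval c ≠ 0 := by
  classical
  have hinj : Function.Injective fun i : ℕ => q ^ i := by
    intro i j hij
    have h1 := emultiplicity_pow_self_of_prime hq i
    have h2 := emultiplicity_pow_self_of_prime hq j
    rw [show q ^ i = q ^ j from hij, h2] at h1
    exact_mod_cast h1.symm
  let J : Finset A := (Finset.range (2 * n + 1)).image fun i => q ^ i
  have hJ : J.card = 2 * n + 1 := by
    rw [Finset.card_image_of_injective _ hinj, Finset.card_range]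
  have hr : P.roots.toFinset.card ≤ n :=
    (Multiset.toFinset_card_le _).trans ((card_roots' P).trans hn)
  have h1 : n + 1 ≤ (J \ P.roots.toFinset).card := by
    have := Finset.le_card_sdiff P.roots.toFinset J
    omega
  obtain ⟨I, hI, hIc⟩ := Finset.exists_subset_card_eq h1
  refine ⟨I, hIc, fun c hc => ?_⟩
  obtain ⟨hcJ, hcr⟩ := Finset.mem_sdiff.1 (hI hc)
  obtain ⟨i, hi, rfl⟩ := Finset.mem_image.1 hcJ
  refine ⟨⟨i, by have := Finset.mem_range.1 hi; omega, rfl⟩, fun h => hcr ?_⟩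
  simpa [hP] using h

/-- Kronecker's method: the values of a divisor of `P` at powers of `q` divide those of `P`, and
they determine the divisor. The powers `q ^ i` with `i ≤ 2 * n` are available after `2 * n + 2`
rounds, the values of `P` after `2 * n` more, their divisors in the next one, and the interpolation
takes `6 * n`. -/
theorem coeff_mem_reach_of_dvd {q : A} (hq : Prime q) {P Q : A[X]} (hP : P ≠ 0) (hQP : Q ∣ P)
    {n : ℕ} (hn : P.natDegree ≤ n) (hqS : q ∈ S) (hS : ∀ i ≤ P.natDegree, P.coeff i ∈ S) (i : ℕ) :
    Q.coeff i ∈ Reach S (10 * n + 3) := by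
  have hq0 : q ∈ Reach S 0 := hqS
  have h1 : (1 : A) ∈ Reach S 1 := dvd_mem_reach hq0 hq.ne_zero (one_dvd _)
  have hn1 : (-1 : A) ∈ Reach S 1 := dvd_mem_reach hq0 hq.ne_zero (neg_dvd.2 (one_dvd _))
  have h0 : (0 : A) ∈ Reach S 2 := by simpa using add_mem_reach h1 hn1
  have hpow : ∀ i, q ^ i ∈ Reach S (2 + i) := by
    intro i
    induction i with
    | zero => simpa using reach_mono (by omega) h1
    | succ i ih =>
      rw [pow_succ]
      exact reach_mono (by omega) (mul_mem_reach ih (reach_mono (by omega) hq0))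
  have hPS : ∀ i, P.coeff i ∈ Reach S 2 := by
    intro i
    rcases le_or_gt i P.natDegree with h | h
    · exact reach_mono (Nat.zero_le 2) (hS i h)
    · rwa [coeff_eq_zero_of_natDegree_lt h]
  obtain ⟨I, hI, hIP⟩ := exists_powers_eval_ne_zero hq hP hn
  have hIc : ∀ c ∈ I, c ∈ Reach S (2 + 2 * n) := by
    intro c hc
    obtain ⟨⟨i, hi, rfl⟩, -⟩ := hIP c hc
    exact reach_mono (by omega) (hpow i)
  have hQc : ∀ c ∈ I, Q.eval c ∈ Reach S (4 * n + 3) := fun c hc =>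
    reach_mono (by omega) (dvd_mem_reach (eval_mem_reach (hIc c hc) n P hn
      fun i => reach_mono (by omega) (hPS i)) (hIP c hc).2 (eval_dvd hQP))
  have := coeff_mem_reach_of_eval n (4 * n + 3) I Q ((natDegree_le_of_dvd hQP hP).trans hn) hI
    (reach_mono (by omega) h0) (reach_mono (by omega) hn1)
    (fun c hc => reach_mono (by omega) (hIc c hc)) hQc i
  exact reach_mono (by omega) this

end

/-! ### Folding and mapping partial recursive functions over lists -/

section

theorem partrec_list_foldlM {α β σ : Type} [Primcodable α] [Primcodable β] [Primcodable σ]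
    {f : α → List β} {g : α → σ} {h : α → σ × β →. σ}
    (hf : Computable f) (hg : Computable g) (hh : Partrec₂ h) :
    Partrec fun a => (f a).foldlM (fun s b => h a (s, b)) (g a) := by
  have h1 : Partrec₂ fun (a : α) (p : ℕ × σ) =>
      (Option.casesOn (f a)[p.1]? (Part.some p.2) fun b => h a (p.2, b) : Part σ) :=
    Partrec.optionCasesOn_right (o := fun x : α × ℕ × σ => (f x.1)[x.2.1]?)
      (f := fun x => x.2.2) (g := fun x b => h x.1 (x.2.2, b))
      (Computable.list_getElem?.comp (hf.comp .fst) (Computable.fst.comp .snd))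
      (Computable.snd.comp .snd)
      (hh.comp (Computable.fst.comp .fst)
        ((Computable.snd.comp (Computable.snd.comp .fst)).pair .snd))
  refine (Partrec.nat_rec (Computable.list_length.comp hf) hg.partrec h1).of_eq fun a => ?_
  suffices H : ∀ n : ℕ, (Nat.rec (Part.some (g a)) (fun y IH => IH.bind fun i =>
      (Option.casesOn (f a)[y]? (Part.some i) fun b => h a (i, b) : Part σ)) n : Part σ) =
      ((f a).take n).foldlM (fun s b => h a (s, b)) (g a) by
    simpa using H (f a).length
  intro n
  induction n with
  | zero => rfl
  | succ n ih =>
    rw [List.take_add_one, List.foldlM_append, ← ih]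
    change Part.bind _ _ = Part.bind _ _
    congr 1
    funext s
    rcases (f a)[n]? with _ | b
    · rfl
    · simp

/-- The list of the values of a partial function on a list, defined if they all are. -/
def mapPart {β σ : Type} (h : β → Part σ) (l : List β) : Part (List σ) :=
  l.foldlM (fun s b => (h b).map fun c => s ++ [c]) []

theorem partrec_mapPart {α β σ : Type} [Primcodable α] [Primcodable β] [Primcodable σ]
    {f : α → List β} {h : α → β →. σ} (hf : Computable f) (hh : Partrec₂ h) :
    Partrec fun a => mapPart (h a) (f a) :=
  partrec_list_foldlM (h := fun a p => (h a p.2).map fun c => p.1 ++ [c]) hf (.const [])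
    (Partrec.map (hh.comp .fst (Computable.snd.comp .snd))
      (Computable.list_concat.comp (Computable.fst.comp (Computable.snd.comp .fst)) .snd))

theorem foldlM_map_eq_some {σ τ β γ : Type*} {h : σ → β → Part σ} {c : τ → σ} {d : γ → β}
    {k : τ → γ → τ} {l : List γ} (H : ∀ t, ∀ b ∈ l, h (c t) (d b) = Part.some (c (k t b))) (t : τ) :
    (l.map d).foldlM h (c t) = Part.some (c (l.foldl k t)) := by
  induction l generalizing t with
  | nil => rfl
  | cons b l ih =>
    rw [List.map_cons, List.foldlM_cons, H t b (by simp), List.foldl_cons]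
    exact (Part.bind_some _ _).trans (ih (fun t b hb => H t b (by simp [hb])) _)

theorem foldlM_eq_some {σ β : Type*} {h : σ → β → Part σ} {k : σ → β → σ} {l : List β}
    (H : ∀ s, ∀ b ∈ l, h s b = Part.some (k s b)) (s : σ) :
    l.foldlM h s = Part.some (l.foldl k s) := by
  simpa using foldlM_map_eq_some (c := id) (d := id) H s

theorem mapPart_map_eq_some {β σ : Type} {γ : Type*} {h : β → Part σ} {d : γ → β} {k : γ → σ}
    {l : List γ} (H : ∀ b ∈ l, h (d b) = Part.some (k b)) :
    mapPart h (l.map d) = Part.some (l.map k) := by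
  refine (foldlM_map_eq_some (h := fun s b => (h b).map fun c => s ++ [c]) (c := id)
    (k := fun s b => s ++ [k b]) (fun s b hb => by simp [H b hb]) []).trans ?_
  congr 1
  suffices ∀ s, l.foldl (fun s b => s ++ [k b]) s = s ++ l.map k from this []
  clear H
  induction l with
  | nil => simp
  | cons b l ih => intro s; simp [ih]

theorem mapPart_eq_some {β σ : Type} {h : β → Part σ} {k : β → σ} {l : List β}
    (H : ∀ b ∈ l, h b = Part.some (k b)) : mapPart h l = Part.some (l.map k) := by
  simpa using mapPart_map_eq_some (d := id) H

/-- The s-m-n theorem: a partial recursive function with a parameter has an index that is computed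
from the parameter. -/
theorem exists_computable_index {α : Type*} [Primcodable α] {Φ : α → ℕ →. ℕ} (h : Partrec₂ Φ) :
    ∃ t : α → Code, Computable t ∧ ∀ a n, (t a).eval n = Φ a n := by
  have h1 : Partrec fun m : ℕ => (Part.ofOption (Encodable.decode (α := α) m.unpair.1)).bind
      fun a => Φ a m.unpair.2 :=
    Partrec.bind (Computable.ofOption (Computable.decode.comp (Computable.fst.comp .unpair)))
      (h.comp .snd (Computable.snd.comp (Computable.unpair.comp .fst)))
  obtain ⟨c, hc⟩ := Code.exists_code.1 (Partrec.nat_iff.1 h1)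
  refine ⟨fun a => c.curry (Encodable.encode a),
    Code.primrec₂_curry.to_comp.comp (.const c) .encode, fun a n => ?_⟩
  rw [Code.eval_curry, hc]
  simp

end

/-! ### Canonical indices, normal forms and tuples of lists -/

section

theorem primrec_two_pow : Primrec fun n : ℕ => 2 ^ n :=
  (Primrec₂.unpaired'.1 Nat.Primrec.pow).comp (.const 2) .id

theorem primrecRel_bit : PrimrecRel fun n u : ℕ => u / 2 ^ n % 2 = 1 :=
  Primrec.eq.comp (Primrec.nat_mod.comp (Primrec.nat_div.comp .snd (primrec_two_pow.comp .fst))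
    (.const 2)) (.const 1)

theorem mem_canonicalSet {n u : ℕ} : n ∈ canonicalSet u ↔ u / 2 ^ n % 2 = 1 := by
  rw [canonicalSet, List.mem_toFinset, Nat.mem_bitIndices, Nat.testBit_eq_decide_div_mod_eq,
    decide_eq_true_iff]

/-- The list of the elements of the finite set with canonical index `u`. -/
def bitList (u : ℕ) : List ℕ := (List.range u).filter fun n => u / 2 ^ n % 2 = 1

theorem primrec_bitList : Primrec bitList :=
  primrecRel_bit.listFilter.comp Primrec.list_range .id

theorem mem_bitList {n u : ℕ} : n ∈ bitList u ↔ n ∈ canonicalSet u := by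
  rw [mem_canonicalSet, bitList, List.mem_filter, List.mem_range, decide_eq_true_iff,
    and_iff_right_iff_imp]
  intro h
  by_contra! hn
  rw [Nat.div_eq_of_lt (hn.trans_lt Nat.lt_two_pow_self)] at h
  simp at h

theorem mem_bitList_canonicalIndex {n : ℕ} {S : Finset ℕ} :
    n ∈ bitList (canonicalIndex S) ↔ n ∈ S := by
  rw [mem_bitList, canonicalSet_canonicalIndex]

/-- The canonical index of the set of the elements of a list. -/
def listIndex (l : List ℕ) : ℕ := l.foldl (fun u n => if u / 2 ^ n % 2 = 1 then u else u + 2 ^ n) 0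

theorem primrec_listIndex : Primrec listIndex :=
  Primrec.list_foldl (h := fun _ p => if p.1 / 2 ^ p.2 % 2 = 1 then p.1 else p.1 + 2 ^ p.2)
    .id (.const 0) (Primrec.ite (primrecRel_bit.comp (Primrec.snd.comp .snd)
      (Primrec.fst.comp .snd)) (Primrec.fst.comp .snd) (Primrec.nat_add.comp
        (Primrec.fst.comp .snd) (primrec_two_pow.comp (Primrec.snd.comp .snd))))

theorem listIndex_eq (l : List ℕ) : listIndex l = canonicalIndex l.toFinset := by
  suffices ∀ S : Finset ℕ, l.foldl (fun u n => if u / 2 ^ n % 2 = 1 then u else u + 2 ^ n)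
      (canonicalIndex S) = canonicalIndex (S ∪ l.toFinset) by
    simpa [listIndex, canonicalIndex] using this ∅
  induction l with
  | nil => simp
  | cons a l ih =>
    intro S
    have h : (if canonicalIndex S / 2 ^ a % 2 = 1 then canonicalIndex S
        else canonicalIndex S + 2 ^ a) = canonicalIndex (insert a S) := by
      simp only [← mem_canonicalSet, canonicalSet_canonicalIndex]
      split_ifs with ha
      · rw [Finset.insert_eq_of_mem ha]
      · rw [canonicalIndex, canonicalIndex, Finset.sum_insert ha, add_comm]
    rw [List.foldl_cons, h, ih, List.toFinset_cons, Finset.insert_union, Finset.union_insert]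

theorem canonicalRelabel_eq (ι : ℕ → ℕ) (u : ℕ) :
    canonicalRelabel ι u = listIndex ((bitList u).map ι) := by
  rw [canonicalRelabel, listIndex_eq]
  congr 1
  ext n
  simp [mem_bitList]

theorem primrec_getD {α : Type*} [Primcodable α] {l : α → List ℕ} {i z : α → ℕ} (hl : Primrec l)
    (hi : Primrec i) (hz : Primrec z) : Primrec fun a => (l a).getD (i a) (z a) :=
  (Primrec.option_getD.comp (Primrec.list_getElem?.comp hl hi) hz).of_eq fun _ =>
    List.getD_eq_getElem?_getD.symm

/-- A list without its trailing entries `z`. -/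
def trim (z : ℕ) (l : List ℕ) : List ℕ :=
  l.foldr (fun a s => if a = z ∧ s.length = 0 then [] else a :: s) []

theorem primrec_trim : Primrec₂ trim :=
  Primrec.list_foldr (h := fun (x : ℕ × List ℕ) (p : ℕ × List ℕ) =>
    if p.1 = x.1 ∧ p.2.length = 0 then [] else p.1 :: p.2) .snd (.const [])
    (Primrec.ite ((Primrec.eq.comp (Primrec.fst.comp .snd) (Primrec.fst.comp .fst)).and
      (Primrec.eq.comp (Primrec.list_length.comp (Primrec.snd.comp .snd)) (.const 0)))
      (.const []) (Primrec.list_cons.comp (Primrec.fst.comp .snd) (Primrec.snd.comp .snd)))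

theorem trim_concat_self (z : ℕ) (l : List ℕ) : trim z (l ++ [z]) = trim z l := by
  simp [trim]

theorem trim_concat_of_ne {z a : ℕ} (h : a ≠ z) (l : List ℕ) : trim z (l ++ [a]) = l ++ [a] := by
  induction l with
  | nil => simp [trim, h]
  | cons b l ih =>
    rw [trim] at ih
    rw [trim, List.cons_append, List.foldr_cons, ih]
    simp

/-- The code of the polynomial with the given list of (codes of) coefficients, where `z` is the code
of `0`: a constant gets twice the code of its value, every other polynomial an odd number that
determines the list of its coefficients. -/
def pack (z : ℕ) (l : List ℕ) : ℕ :=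
  if (trim z l).length ≤ 1 then 2 * (trim z l).getD 0 z else 2 * Encodable.encode (trim z l) + 1

theorem primrec_pack : Primrec₂ pack := by
  have h : Primrec fun p : ℕ × List ℕ => trim p.1 p.2 := primrec_trim
  exact Primrec.ite (Primrec.nat_le.comp (Primrec.list_length.comp h) (.const 1))
    (Primrec.nat_double.comp (primrec_getD h (.const 0) .fst))
    (Primrec.nat_double_succ.comp (Primrec.encode.comp h))

/-- The list of coefficients of the polynomial with a given code. -/
def unpack (n : ℕ) : List ℕ :=
  if n % 2 = 0 then [n / 2] else (Encodable.decode (n / 2)).getD []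

theorem primrec_unpack : Primrec unpack :=
  Primrec.ite (Primrec.eq.comp (Primrec.nat_mod.comp .id (.const 2)) (.const 0))
    (Primrec.list_cons.comp (Primrec.nat_div.comp .id (.const 2)) (.const []))
    (Primrec.option_getD.comp (Primrec.decode.comp (Primrec.nat_div.comp .id (.const 2)))
      (.const []))

/-- All lists of length `n` with entries in `L`. -/
def tuples (L : List ℕ) (n : ℕ) : List (List ℕ) :=
  Nat.rec [[]] (fun _ T => L.flatMap fun a => T.map fun t => a :: t) n

theorem primrec_tuples : Primrec₂ tuples :=
  Primrec.nat_rec' (f := fun p : List ℕ × ℕ => p.2) (g := fun _ => [[]])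
    (h := fun p s => p.1.flatMap fun a => s.2.map fun t => a :: t) .snd (.const _)
    (Primrec.list_flatMap (Primrec.fst.comp .fst) (Primrec.list_map
      (Primrec.snd.comp (Primrec.snd.comp .fst))
      (Primrec.list_cons.comp (Primrec.snd.comp .fst) .snd)))

theorem mem_tuples {L t : List ℕ} {n : ℕ} : t ∈ tuples L n ↔ t.length = n ∧ ∀ a ∈ t, a ∈ L := by
  induction n generalizing t with
  | zero =>
    change t ∈ [[]] ↔ _
    rw [List.mem_singleton, List.length_eq_zero_iff]
    exact ⟨fun h => ⟨h, by simp [h]⟩, And.left⟩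
  | succ n ih =>
    change t ∈ L.flatMap (fun a => (tuples L n).map fun t => a :: t) ↔ _
    simp only [List.mem_flatMap, List.mem_map, ih]
    constructor
    · rintro ⟨a, ha, t, ⟨rfl, ht⟩, rfl⟩
      simpa [ha] using ht
    · rintro ⟨hl, ht⟩
      cases t with
      | nil => simp at hl
      | cons a t =>
        simp only [List.length_cons, Nat.add_right_cancel_iff] at hl
        simp only [List.mem_cons, forall_eq_or_imp] at ht
        exact ⟨a, ht.1, t, ⟨hl, ht.2⟩, rfl⟩

/-- All pairs of elements of a list. -/
def pairs (L : List ℕ) : List (ℕ × ℕ) := L.flatMap fun a => L.map fun b => (a, b)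

theorem primrec_pairs : Primrec pairs :=
  Primrec.list_flatMap .id (Primrec.list_map .fst (Primrec.pair (Primrec.snd.comp .fst) .snd))

theorem mem_pairs {L : List ℕ} {p : ℕ × ℕ} : p ∈ pairs L ↔ p.1 ∈ L ∧ p.2 ∈ L := by
  rcases p with ⟨a, b⟩
  simp [pairs]

end

/-! ### The programs for `B` -/

section

/-- What the programs for `B` start from: indices for `A` and the codes of `q` and of `0`. -/
abbrev Env : Type := SCFFDIndex × ℕ × ℕ

variable {α : Type} [Primcodable α] {E : α → Env} {f g : α → ℕ} {l l' : α → List ℕ}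

/-- The code of `q`. -/
def Env.q (E : Env) : ℕ := E.2.1

/-- The code of `0`. -/
def Env.z (E : Env) : ℕ := E.2.2

theorem computable_q (hE : Computable E) : Computable fun x => (E x).q :=
  Computable.fst.comp (Computable.snd.comp hE)

theorem computable_z (hE : Computable E) : Computable fun x => (E x).z :=
  Computable.snd.comp (Computable.snd.comp hE)

theorem computable_pack (hE : Computable E) (hl : Computable l) :
    Computable fun x => pack (E x).z (l x) :=
  primrec_pack.to_comp.comp (computable_z hE) hl

theorem computable_getD (hE : Computable E) (hl : Computable l) (hf : Computable f) :
    Computable fun x => (l x).getD (f x) (E x).z :=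
  (primrec_getD (.fst) (Primrec.fst.comp .snd) (Primrec.snd.comp .snd)).to_comp.comp
    (hl.pair (hf.pair (computable_z hE)))

/-- Membership in `A`. -/
def isMem (e : SCFFDIndex) (n : ℕ) : Part Bool := (e.1.1.eval n).map fun m => decide (m = 1)

/-- Addition in `A`. -/
def addA (e : SCFFDIndex) (a b : ℕ) : Part ℕ := e.1.2.1.eval (Nat.pair a b)

/-- Multiplication in `A`. -/
def mulA (e : SCFFDIndex) (a b : ℕ) : Part ℕ := e.1.2.2.eval (Nat.pair a b)

theorem computable_eq_nat (hf : Computable f) (hg : Computable g) :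
    Computable fun x => decide (f x = g x) :=
  (Primrec.eq (α := ℕ)).decide.to_comp.comp hf hg

theorem partrec_isMem {e : α → SCFFDIndex} (he : Computable e) (hf : Computable f) :
    Partrec fun x => isMem (e x) (f x) :=
  Partrec.map (Code.eval_part.comp (Computable.fst.comp (Computable.fst.comp he)) hf)
    (computable_eq_nat .snd (.const 1))

theorem partrec_addA {e : α → SCFFDIndex} (he : Computable e) (hf : Computable f)
    (hg : Computable g) : Partrec fun x => addA (e x) (f x) (g x) :=
  Code.eval_part.comp (Computable.fst.comp (Computable.snd.comp (Computable.fst.comp he)))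
    (Primrec₂.natPair.to_comp.comp hf hg)

theorem partrec_mulA {e : α → SCFFDIndex} (he : Computable e) (hf : Computable f)
    (hg : Computable g) : Partrec fun x => mulA (e x) (f x) (g x) :=
  Code.eval_part.comp (Computable.snd.comp (Computable.snd.comp (Computable.fst.comp he)))
    (Primrec₂.natPair.to_comp.comp hf hg)

/-- The code of `0` is found by searching for an element `n` of `A` with `n + n = n`. -/
def findZero (e : SCFFDIndex) : Part ℕ :=
  Nat.rfind fun n => (isMem e n).bind fun b =>
    cond b ((addA e n n).map fun m => decide (m = n)) (Part.some false)

theorem partrec_findZero {e : α → SCFFDIndex} (he : Computable e) :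
    Partrec fun x => findZero (e x) :=
  Partrec.rfind (Partrec.bind (partrec_isMem (he.comp .fst) .snd)
    (Partrec.cond .snd (Partrec.map (partrec_addA (he.comp (Computable.fst.comp .fst))
      (Computable.snd.comp .fst) (Computable.snd.comp .fst))
      (computable_eq_nat .snd (Computable.snd.comp (Computable.fst.comp .fst))))
      (Computable.const false)))

/-- Whether all entries of a list belong to `A`. -/
def allMem (E : Env) (l : List ℕ) : Part Bool :=
  l.foldlM (fun s n => (isMem E.1 n).map fun b => s && b) true

theorem partrec_allMem (hE : Computable E) (hl : Computable l) :
    Partrec fun x => allMem (E x) (l x) :=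
  partrec_list_foldlM (h := fun x p => (isMem (E x).1 p.2).map fun b => p.1 && b) hl (.const true)
    (Partrec.map (partrec_isMem (Computable.fst.comp (hE.comp .fst)) (Computable.snd.comp .snd))
      (Primrec.and.to_comp.comp (Computable.fst.comp (Computable.snd.comp .fst)) .snd))

/-- The list of the divisors of a nonzero `a` in `A`, and the empty list for `a = 0`, where the
divisor function of `A` may be undefined. -/
def divsA (E : Env) (a : ℕ) : Part (List ℕ) :=
  cond (decide (a = E.z)) (Part.some []) ((E.1.2.eval a).map bitList)

theorem partrec_divsA (hE : Computable E) (hf : Computable f) :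
    Partrec fun x => divsA (E x) (f x) :=
  Partrec.cond (computable_eq_nat hf (computable_z hE)) (Computable.const [])
    (Partrec.map (Code.eval_part.comp (Computable.snd.comp (Computable.fst.comp hE)) hf)
      (primrec_bitList.to_comp.comp .snd))

/-- Divisibility by `q` in `A`. -/
def qDvd (E : Env) (a : ℕ) : Part Bool :=
  cond (decide (a = E.z)) (Part.some true)
    ((E.1.2.eval a).map fun u => decide (u / 2 ^ E.q % 2 = 1))

theorem partrec_qDvd (hE : Computable E) (hf : Computable f) :
    Partrec fun x => qDvd (E x) (f x) :=
  Partrec.cond (computable_eq_nat hf (computable_z hE)) (Computable.const true)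
    (Partrec.map (Code.eval_part.comp (Computable.snd.comp (Computable.fst.comp hE)) hf)
      (primrecRel_bit.decide.to_comp.comp (computable_q (hE.comp .fst)) .snd))

/-- Membership in `B`: the coefficients are in `A`, the one of `X` is divisible by `q`, and the code
is the one in normal form. -/
def memB (E : Env) (n : ℕ) : Part Bool :=
  (allMem E (unpack n)).bind fun b =>
    cond (b && decide (pack E.z (unpack n) = n)) (qDvd E ((unpack n).getD 1 E.z)) (Part.some false)

theorem partrec_memB (hE : Computable E) (hf : Computable f) :
    Partrec fun x => memB (E x) (f x) := by
  have hu : Computable fun x => unpack (f x) := primrec_unpack.to_comp.comp hf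
  exact Partrec.bind (partrec_allMem hE hu) (Partrec.cond (Primrec.and.to_comp.comp .snd
    (computable_eq_nat (computable_pack (hE.comp .fst) (hu.comp .fst)) (hf.comp .fst)))
    (partrec_qDvd (hE.comp .fst) (computable_getD (hE.comp .fst) (hu.comp .fst) (.const 1)))
    (Computable.const false))

/-- Addition of polynomials given by lists of coefficients. -/
def addL (E : Env) (l l' : List ℕ) : Part (List ℕ) :=
  mapPart (fun i => addA E.1 (l.getD i E.z) (l'.getD i E.z)) (List.range (l.length + l'.length))

theorem computable_range_add (hl : Computable l) (hl' : Computable l') :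
    Computable fun x => List.range ((l x).length + (l' x).length) :=
  Primrec.list_range.to_comp.comp (Primrec.nat_add.to_comp.comp (Computable.list_length.comp hl)
    (Computable.list_length.comp hl'))

theorem partrec_addL (hE : Computable E) (hl : Computable l) (hl' : Computable l') :
    Partrec fun x => addL (E x) (l x) (l' x) :=
  partrec_mapPart (h := fun x i => addA (E x).1 ((l x).getD i (E x).z) ((l' x).getD i (E x).z))
    (computable_range_add hl hl')
    (partrec_addA (Computable.fst.comp (hE.comp .fst))
      (computable_getD (hE.comp .fst) (hl.comp .fst) .snd)
      (computable_getD (hE.comp .fst) (hl'.comp .fst) .snd))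

/-- The `k`-th coefficient of a product of polynomials given by lists of coefficients. -/
def mulCoeff (E : Env) (l l' : List ℕ) (k : ℕ) : Part ℕ :=
  (List.range (k + 1)).foldlM
    (fun s i => (mulA E.1 (l.getD i E.z) (l'.getD (k - i) E.z)).bind fun m => addA E.1 s m) E.z

theorem partrec_mulCoeff (hE : Computable E) (hl : Computable l) (hl' : Computable l')
    (hf : Computable f) : Partrec fun x => mulCoeff (E x) (l x) (l' x) (f x) :=
  partrec_list_foldlM (h := fun x p => (mulA (E x).1 ((l x).getD p.2 (E x).z)
      ((l' x).getD (f x - p.2) (E x).z)).bind fun m => addA (E x).1 p.1 m)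
    (Primrec.list_range.to_comp.comp (Computable.succ.comp hf)) (computable_z hE)
    (Partrec.bind (partrec_mulA (Computable.fst.comp (hE.comp .fst))
      (computable_getD (hE.comp .fst) (hl.comp .fst) (Computable.snd.comp .snd))
      (computable_getD (hE.comp .fst) (hl'.comp .fst)
        (Primrec.nat_sub.to_comp.comp (hf.comp .fst) (Computable.snd.comp .snd))))
      (partrec_addA (Computable.fst.comp (hE.comp (Computable.fst.comp .fst)))
        (Computable.fst.comp (Computable.snd.comp .fst)) .snd))

/-- Multiplication of polynomials given by lists of coefficients. -/
def mulL (E : Env) (l l' : List ℕ) : Part (List ℕ) :=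
  mapPart (fun k => mulCoeff E l l' k) (List.range (l.length + l'.length))

theorem partrec_mulL (hE : Computable E) (hl : Computable l) (hl' : Computable l') :
    Partrec fun x => mulL (E x) (l x) (l' x) :=
  partrec_mapPart (h := fun x k => mulCoeff (E x) (l x) (l' x) k) (computable_range_add hl hl')
    (partrec_mulCoeff (hE.comp .fst) (hl.comp .fst) (hl'.comp .fst) .snd)

/-- Addition in `B`. -/
def addB (E : Env) (n m : ℕ) : Part ℕ := (addL E (unpack n) (unpack m)).map fun l => pack E.z l

theorem partrec_addB (hE : Computable E) (hf : Computable f) (hg : Computable g) :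
    Partrec fun x => addB (E x) (f x) (g x) :=
  Partrec.map (partrec_addL hE (primrec_unpack.to_comp.comp hf) (primrec_unpack.to_comp.comp hg))
    (computable_pack (hE.comp .fst) .snd)

/-- Multiplication in `B`. -/
def mulB (E : Env) (n m : ℕ) : Part ℕ := (mulL E (unpack n) (unpack m)).map fun l => pack E.z l

theorem partrec_mulB (hE : Computable E) (hf : Computable f) (hg : Computable g) :
    Partrec fun x => mulB (E x) (f x) (g x) :=
  Partrec.map (partrec_mulL hE (primrec_unpack.to_comp.comp hf) (primrec_unpack.to_comp.comp hg))
    (computable_pack (hE.comp .fst) .snd)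

/-- Adjoins to a list all sums and products of its elements and their divisors, if nonzero. -/
def closeStep (E : Env) (L : List ℕ) : Part (List ℕ) :=
  (mapPart (fun p : ℕ × ℕ => addA E.1 p.1 p.2) (pairs L)).bind fun s =>
    (mapPart (fun p : ℕ × ℕ => mulA E.1 p.1 p.2) (pairs L)).bind fun m =>
      (mapPart (fun a => divsA E a) L).map fun d => L ++ (s ++ (m ++ d.flatten))

theorem partrec_closeStep (hE : Computable E) (hl : Computable l) :
    Partrec fun x => closeStep (E x) (l x) := by
  have hp : Computable fun x => pairs (l x) := primrec_pairs.to_comp.comp hl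
  refine Partrec.bind (partrec_mapPart (h := fun x (p : ℕ × ℕ) => addA (E x).1 p.1 p.2) hp
    (partrec_addA (Computable.fst.comp (hE.comp .fst)) (Computable.fst.comp .snd)
      (Computable.snd.comp .snd))) ?_
  refine Partrec.bind (partrec_mapPart (h := fun x (p : ℕ × ℕ) => mulA (E x.1).1 p.1 p.2)
    (hp.comp .fst) (partrec_mulA (Computable.fst.comp (hE.comp (Computable.fst.comp .fst)))
      (Computable.fst.comp .snd) (Computable.snd.comp .snd))) ?_
  refine Partrec.map (partrec_mapPart (h := fun x a => divsA (E x.1.1) a)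
    (hl.comp (Computable.fst.comp .fst))
    (partrec_divsA (hE.comp (Computable.fst.comp (Computable.fst.comp .fst))) .snd)) ?_
  exact Computable.list_append.comp (hl.comp (Computable.fst.comp (Computable.fst.comp .fst)))
    (Computable.list_append.comp (Computable.snd.comp (Computable.fst.comp .fst))
      (Computable.list_append.comp (Computable.snd.comp .fst)
        (Primrec.list_flatten.to_comp.comp .snd)))

/-- The iterates of `closeStep`. -/
def closeIter (E : Env) (L : List ℕ) (n : ℕ) : Part (List ℕ) :=
  Nat.rec (Part.some L) (fun _ IH => IH.bind fun L' => closeStep E L') n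

theorem partrec_closeIter (hE : Computable E) (hl : Computable l) (hf : Computable f) :
    Partrec fun x => closeIter (E x) (l x) (f x) :=
  Partrec.nat_rec (h := fun x p => closeStep (E x) p.2) hf hl
    (partrec_closeStep (hE.comp .fst) (Computable.snd.comp .snd))

/-- Appends `a` to the list `s` if `a` and `b` are codes of elements of `B` with product `n`. -/
def tryDivisor (E : Env) (n a b : ℕ) (s : List ℕ) : Part (List ℕ) :=
  (memB E a).bind fun c => (memB E b).bind fun d =>
    cond (c && d) ((mulB E a b).map fun m => cond (decide (m = n)) (s ++ [a]) s) (Part.some s)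

theorem partrec_tryDivisor {n : α → ℕ} (hE : Computable E) (hn : Computable n) (hf : Computable f)
    (hg : Computable g) (hl : Computable l) :
    Partrec fun x => tryDivisor (E x) (n x) (f x) (g x) (l x) := by
  refine Partrec.bind (partrec_memB hE hf) ?_
  refine Partrec.bind (partrec_memB (hE.comp .fst) (hg.comp .fst)) ?_
  have h1 : Computable fun x : (α × Bool) × Bool => x.1.1 := Computable.fst.comp .fst
  exact Partrec.cond (Primrec.and.to_comp.comp (Computable.snd.comp .fst) .snd)
    (Partrec.map (partrec_mulB (hE.comp h1) (hf.comp h1) (hg.comp h1))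
      (Computable.cond (computable_eq_nat .snd (hn.comp (h1.comp .fst)))
        (Computable.list_concat.comp (hl.comp (h1.comp .fst)) (hf.comp (h1.comp .fst)))
        (hl.comp (h1.comp .fst))))
    (hl.comp h1)

/-- All pairs of codes of polynomials given by `k` coefficients in the list `L`. -/
def candidates (z : ℕ) (L : List ℕ) (k : ℕ) : List (ℕ × ℕ) :=
  pairs ((tuples L k).map fun t => pack z t)

theorem computable_candidates (hf : Computable f) (hl : Computable l) (hg : Computable g) :
    Computable fun x => candidates (f x) (l x) (g x) := by
  have h1 : Primrec fun p : ℕ × List (List ℕ) => p.2.map fun t => pack p.1 t :=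
    Primrec.list_map .snd (primrec_pack.comp₂ (Primrec.fst.comp₂ .left) .right)
  have h2 : Computable fun x => tuples (l x) (g x) := primrec_tuples.to_comp.comp hl hg
  have h3 : Computable fun x => (f x, tuples (l x) (g x)) := hf.pair h2
  have h4 : Computable fun x => (tuples (l x) (g x)).map fun t => pack (f x) t := h1.to_comp.comp h3
  exact primrec_pairs.to_comp.comp h4

/-- The canonical index of the set of codes of divisors in `B` of a nonconstant polynomial, found
among the polynomials of bounded degree with coefficients in the closure, under sufficiently many
operations, of `q` and of the coefficients of the polynomial. -/
def divNonconst (E : Env) (n : ℕ) : Part ℕ :=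
  (closeIter E (E.q :: unpack n) (10 * (unpack n).length + 3)).bind fun L =>
    ((candidates E.z L (unpack n).length).foldlM
      (fun s p => tryDivisor E n p.1 p.2 s) []).map listIndex

theorem partrec_divNonconst (hE : Computable E) (hf : Computable f) :
    Partrec fun x => divNonconst (E x) (f x) := by
  have hu : Computable fun x => unpack (f x) := primrec_unpack.to_comp.comp hf
  have hc : Computable fun x => (unpack (f x)).length := Computable.list_length.comp hu
  have hk : Computable fun x => 10 * (unpack (f x)).length + 3 :=
    (Primrec.nat_add.comp (Primrec.nat_mul.comp (.const 10) .id) (.const 3)).to_comp.comp hc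
  have hl : Computable fun x => (E x).q :: unpack (f x) :=
    Computable.list_cons.comp (computable_q hE) hu
  have h1 : Partrec fun x => closeIter (E x) ((E x).q :: unpack (f x))
      (10 * (unpack (f x)).length + 3) := partrec_closeIter hE hl hk
  have h2 : Computable fun x : α × List ℕ => candidates (E x.1).z x.2 (unpack (f x.1)).length :=
    computable_candidates (computable_z (hE.comp .fst)) .snd (hc.comp .fst)
  have h3 : Partrec₂ fun (x : α × List ℕ) (p : List ℕ × ℕ × ℕ) =>
      tryDivisor (E x.1) (f x.1) p.2.1 p.2.2 p.1 :=
    partrec_tryDivisor (hE.comp (Computable.fst.comp .fst)) (hf.comp (Computable.fst.comp .fst))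
      (Computable.fst.comp (Computable.snd.comp .snd))
      (Computable.snd.comp (Computable.snd.comp .snd)) (Computable.fst.comp .snd)
  have h4 : Partrec₂ fun (x : α) (L : List ℕ) =>
      ((candidates (E x).z L (unpack (f x)).length).foldlM
        (fun s p => tryDivisor (E x) (f x) p.1 p.2 s) []).map listIndex :=
    Partrec.map (partrec_list_foldlM h2 (.const []) h3) (primrec_listIndex.to_comp.comp .snd)
  exact Partrec.bind h1 h4

/-- The divisor function of `B`. On constants it is the one of `A`, wherever that is defined. -/
def divB (E : Env) (n : ℕ) : Part ℕ :=
  cond (decide (n % 2 = 0)) ((E.1.2.eval (n / 2)).map (canonicalRelabel fun n => 2 * n))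
    (divNonconst E n)

theorem partrec_divB (hE : Computable E) (hf : Computable f) :
    Partrec fun x => divB (E x) (f x) := by
  have hr : Computable (canonicalRelabel fun n => 2 * n) :=
    (primrec_listIndex.comp (Primrec.list_map (g := fun _ n => 2 * n) primrec_bitList
      (Primrec.nat_double.comp .snd))).to_comp.of_eq fun u => (canonicalRelabel_eq _ u).symm
  exact Partrec.cond (computable_eq_nat (Primrec.nat_mod.to_comp.comp hf (.const 2)) (.const 0))
    (Partrec.map (Code.eval_part.comp (Computable.snd.comp (Computable.fst.comp hE))
      (Primrec.nat_div.to_comp.comp hf (.const 2))) (hr.comp .snd))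
    (partrec_divNonconst hE hf)

/-- The formation of an element of `B` from a list of elements `aᵢ` of `A`: the polynomial in `A[X]`
has the coefficients `aᵢ`, except for `q a₁` in degree `1`. -/
def formB (E : Env) (l : List ℕ) : Part ℕ :=
  (mapPart (fun i => cond (decide (i = 1)) (mulA E.1 E.q (l.getD i E.z)) (Part.some (l.getD i E.z)))
    (List.range l.length)).map fun t => pack E.z t

theorem partrec_formB (hE : Computable E) (hl : Computable l) :
    Partrec fun x => formB (E x) (l x) := by
  have hg := computable_getD (hE.comp .fst) (hl.comp .fst) (Computable.snd (α := α) (β := ℕ))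
  refine Partrec.map (partrec_mapPart (h := fun x i => cond (decide (i = 1))
    (mulA (E x).1 (E x).q ((l x).getD i (E x).z)) (Part.some ((l x).getD i (E x).z)))
    (Primrec.list_range.to_comp.comp (Computable.list_length.comp hl)) ?_)
    (computable_pack (hE.comp .fst) .snd)
  exact Partrec.cond (computable_eq_nat .snd (.const 1))
    (partrec_mulA (Computable.fst.comp (hE.comp .fst)) (computable_q (hE.comp .fst)) hg) hg

end

/-! ### Codes of polynomials -/

section

variable {A : Type u} [CommRing A] {code : A ↪ ℕ} {P Q : A[X]} {N M : ℕ}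

/-- The list of the codes of the coefficients of `P` below degree `N`. -/
def polyList (code : A ↪ ℕ) (P : A[X]) (N : ℕ) : List ℕ :=
  (List.range N).map fun i => code (P.coeff i)

theorem length_polyList : (polyList code P N).length = N := by simp [polyList]

theorem getD_polyList (h : ∀ i, N ≤ i → P.coeff i = 0) (i : ℕ) :
    (polyList code P N).getD i (code 0) = code (P.coeff i) := by
  rcases lt_or_ge i N with hi | hi
  · simp [polyList, List.getD_eq_getElem?_getD, hi]
  · simp [polyList, List.getD_eq_getElem?_getD, hi, h i hi]

theorem polyList_succ : polyList code P (N + 1) = polyList code P N ++ [code (P.coeff N)] := by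
  simp [polyList, List.range_succ]

/-- The code of a polynomial: a constant `a` gets `2 * code a`, so that there is room for the other
polynomials, which get odd numbers. -/
noncomputable def codeP (code : A ↪ ℕ) (P : A[X]) : ℕ :=
  if P.natDegree = 0 then 2 * code (P.coeff 0)
  else 2 * Encodable.encode (polyList code P (P.natDegree + 1)) + 1

theorem pack_polyList (h : ∀ i, N ≤ i → P.coeff i = 0) :
    pack (code 0) (polyList code P N) = codeP code P := by
  induction N with
  | zero =>
    obtain rfl : P = 0 := by ext i; simpa using h i i.zero_le
    simp [pack, polyList, trim, codeP]
  | succ N ih =>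
    rw [polyList_succ]
    by_cases hN : P.coeff N = 0
    · rw [← ih fun i hi => (Nat.eq_or_lt_of_le hi).elim (fun h' => h' ▸ hN) (h i), hN, pack,
        trim_concat_self, pack]
    · have hd : P.natDegree = N := le_antisymm
        (natDegree_le_iff_coeff_eq_zero.2 fun i hi => h i hi) (le_natDegree_of_ne_zero hN)
      rw [pack, trim_concat_of_ne (fun h' => hN (code.injective h')), codeP, hd, ← polyList_succ,
        length_polyList]
      rcases N with _ | N
      · simp [polyList]
      · simp

theorem coeff_eq_zero_of_le (i : ℕ) (h : P.natDegree + 1 ≤ i) : P.coeff i = 0 :=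
  coeff_eq_zero_of_natDegree_lt h

theorem unpack_codeP : unpack (codeP code P) = polyList code P (P.natDegree + 1) := by
  rw [codeP]
  split_ifs with h
  · simp [unpack, h, polyList]
  · have hdiv : ∀ m, (2 * m + 1) / 2 = m := by omega
    rw [unpack, if_neg (by omega), hdiv, Encodable.encodek]
    rfl

theorem codeP_injective : Function.Injective (codeP code) := by
  intro P Q h
  ext i
  apply code.injective
  rw [← getD_polyList coeff_eq_zero_of_le i, ← getD_polyList coeff_eq_zero_of_le i,
    ← unpack_codeP, h, unpack_codeP]

theorem codeP_C (a : A) : codeP code (C a) = 2 * code a := by simp [codeP]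

/-- A list of codes of elements of `A` is the list of coefficients of a polynomial. -/
theorem exists_polyList_eq (l : List A) :
    ∃ P : A[X], (∀ i, P.coeff i = l.getD i 0) ∧ polyList code P l.length = l.map code := by
  obtain ⟨P, hP⟩ := exists_coeff_eq (fun i => l.getD i 0) (N := l.length)
    (fun i hi => by simp [List.getD_eq_getElem?_getD, hi])
  refine ⟨P, hP, List.ext_getElem (by simp [length_polyList]) fun i h1 h2 => ?_⟩
  rw [length_polyList] at h1
  simp only [polyList, List.getElem_map, List.getElem_range, hP]
  simp [List.getD_eq_getElem?_getD, h1]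

end

/-! ### Correctness of the programs -/

theorem mem_foldl_append_iff {l : List (ℕ × ℕ)} {p : ℕ × ℕ → Prop} [DecidablePred p] {n : ℕ} :
    n ∈ l.foldl (fun s x => if p x then s ++ [x.1] else s) [] ↔ ∃ x ∈ l, p x ∧ x.1 = n := by
  suffices ∀ s : List ℕ, n ∈ l.foldl (fun s x => if p x then s ++ [x.1] else s) s ↔
      n ∈ s ∨ ∃ x ∈ l, p x ∧ x.1 = n by simpa using this []
  induction l with
  | nil => simp
  | cons a l ih =>
    intro s
    rw [List.foldl_cons, ih]
    by_cases ha : p a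
    · simp [ha, or_assoc, eq_comm]
    · simp [ha]

section

variable {A : Type u} [CommRing A] [IsDomain A] {code : A ↪ ℕ} {e : SCFFDIndex}
  (h : IsSCFFD code e) {q : A}

/-- The starting point of the programs, for given indices of `A`. -/
def envOf (code : A ↪ ℕ) (e : SCFFDIndex) (q : A) : Env := (e, code q, code 0)

include h

theorem addA_eq (a b : A) : addA e (code a) (code b) = Part.some (code (a + b)) :=
  h.isComputableRing.eval_add a b

theorem mulA_eq (a b : A) : mulA e (code a) (code b) = Part.some (code (a * b)) :=
  h.isComputableRing.eval_mul a b

open scoped Classical in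
theorem isMem_eq (n : ℕ) : isMem e n = Part.some (decide (n ∈ Set.range code)) := by
  by_cases hn : n ∈ Set.range code
  · simp [isMem, h.isComputableRing.eval_mem n hn, hn, -Set.mem_range]
  · simp [isMem, h.isComputableRing.eval_notMem n hn, hn, -Set.mem_range]

theorem findZero_eq : findZero e = Part.some (code 0) := by
  have key : ∀ a : A, ((isMem e (code a)).bind fun b =>
      cond b ((addA e (code a) (code a)).map fun m => decide (m = code a)) (Part.some false)) =
      Part.some (decide (code (a + a) = code a)) := by
    intro a
    simp [isMem_eq h, addA_eq h]
  refine Part.eq_some_iff.2 (Nat.mem_rfind.2 ⟨?_, fun {m} hm => ?_⟩)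
  · rw [key, add_zero, decide_eq_true rfl]
    exact Part.mem_some _
  by_cases hr : m ∈ Set.range code
  · obtain ⟨a, rfl⟩ := hr
    rw [key, Part.mem_some_iff, eq_comm, decide_eq_false_iff_not]
    intro ha
    have := code.injective ha
    rw [add_eq_left] at this
    exact hm.ne (by rw [this])
  · simp [isMem_eq h, hr, -Set.mem_range]

open scoped Classical in
theorem allMem_eq (l : List ℕ) :
    allMem (envOf code e q) l = Part.some (decide (∀ n ∈ l, n ∈ Set.range code)) := by
  rw [allMem, foldlM_eq_some (k := fun s n => s && decide (n ∈ Set.range code))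
    fun s b _ => by simp [envOf, isMem_eq h]]
  congr 1
  suffices ∀ s, l.foldl (fun s n => s && decide (n ∈ Set.range code)) s =
      (s && decide (∀ n ∈ l, n ∈ Set.range code)) by rw [this, Bool.true_and]
  induction l with
  | nil => simp
  | cons a l ih => intro s; rw [List.foldl_cons, ih]; simp [Bool.and_assoc, -Set.mem_range]

theorem exists_divsA_eq (a : A) : ∃ D : List A,
    divsA (envOf code e q) (code a) = Part.some (D.map code) ∧ ∀ b, b ∈ D ↔ a ≠ 0 ∧ b ∣ a := by
  by_cases ha : a = 0
  · exact ⟨[], by simp [divsA, envOf, Env.z, ha], by simp [ha]⟩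
  · obtain ⟨S, hS, he⟩ := h.eval_divisors a ha
    have hl : ∀ n ∈ bitList (canonicalIndex (S.map code)), ∃ b : A, code b = n := by
      intro n hn
      rw [mem_bitList_canonicalIndex, Finset.mem_map] at hn
      obtain ⟨b, -, hb⟩ := hn
      exact ⟨b, hb⟩
    obtain ⟨D, hD⟩ : ∃ D : List A, D.map code = bitList (canonicalIndex (S.map code)) := by
      rwa [← Set.mem_range, Set.range_list_map]
    refine ⟨D, ?_, fun b => ?_⟩
    · simp [divsA, envOf, Env.z, ha, he, hD]
    · rw [← hS, ← List.mem_map_of_injective code.injective, hD, mem_bitList_canonicalIndex]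
      simp [ha]

open scoped Classical in
theorem qDvd_eq (a : A) : qDvd (envOf code e q) (code a) = Part.some (decide (q ∣ a)) := by
  by_cases ha : a = 0
  · simp [qDvd, envOf, Env.z, ha]
  · obtain ⟨S, hS, he⟩ := h.eval_divisors a ha
    simp only [qDvd, envOf, Env.z, Env.q, EmbeddingLike.apply_eq_iff_eq, ha, decide_false, he,
      Part.map_some, cond_false]
    simp only [← mem_canonicalSet, canonicalSet_canonicalIndex, Finset.mem_map', hS]

open scoped Classical in
theorem memB_eq (n : ℕ) : memB (envOf code e q) n =
    Part.some (decide (∃ P : A[X], q ∣ P.coeff 1 ∧ codeP code P = n)) := by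
  rw [memB, allMem_eq h, Part.bind_some]
  by_cases hl : ∀ m ∈ unpack n, m ∈ Set.range code
  · obtain ⟨l, hl'⟩ : ∃ l : List A, l.map code = unpack n := by
      rwa [← Set.mem_range, Set.range_list_map]
    obtain ⟨P, hP, hPl⟩ := exists_polyList_eq (code := code) l
    have h0 : ∀ i, l.length ≤ i → P.coeff i = 0 := fun i hi => by
      rw [hP, List.getD_eq_getElem?_getD, List.getElem?_eq_none hi]; rfl
    have hn : ∀ Q : A[X], codeP code Q = n → Q = P := by
      rintro Q rfl
      ext i
      apply code.injective
      rw [← getD_polyList coeff_eq_zero_of_le i, ← getD_polyList h0 i, hPl, hl', unpack_codeP]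
    rw [← hl', ← hPl, envOf, Env.z, pack_polyList h0, getD_polyList h0]
    by_cases hc : codeP code P = n
    · rw [hPl, hl', decide_eq_true hl, decide_eq_true hc]
      refine (qDvd_eq h _).trans ?_
      congr 2
      exact propext ⟨fun hq => ⟨P, hq, hc⟩, fun ⟨Q, hQ, hQn⟩ => hn Q hQn ▸ hQ⟩
    · rw [decide_eq_false hc, Bool.and_false, cond_false]
      congr 1
      exact (decide_eq_false fun ⟨Q, hQ, hQn⟩ => hc (hn Q hQn ▸ hQn)).symm
  · rw [decide_eq_false hl]
    simp only [Bool.false_and, cond_false]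
    congr 1
    refine (decide_eq_false ?_).symm
    rintro ⟨P, -, rfl⟩
    refine hl fun m hm => ?_
    rw [unpack_codeP, polyList, List.mem_map] at hm
    obtain ⟨i, -, rfl⟩ := hm
    exact ⟨_, rfl⟩

theorem addB_eq (P Q : A[X]) :
    addB (envOf code e q) (codeP code P) (codeP code Q) = Part.some (codeP code (P + Q)) := by
  rw [addB, addL, unpack_codeP, unpack_codeP, length_polyList, length_polyList,
    mapPart_eq_some (k := fun i => code ((P + Q).coeff i)), Part.map_some]
  · congr 1
    exact pack_polyList fun i hi => by
      rw [coeff_add, coeff_eq_zero_of_le i (by omega), coeff_eq_zero_of_le i (by omega), add_zero]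
  · intro i _
    rw [envOf, Env.z, getD_polyList coeff_eq_zero_of_le, getD_polyList coeff_eq_zero_of_le,
      addA_eq h, coeff_add]

theorem mulB_eq (P Q : A[X]) :
    mulB (envOf code e q) (codeP code P) (codeP code Q) = Part.some (codeP code (P * Q)) := by
  rw [mulB, mulL, unpack_codeP, unpack_codeP, length_polyList, length_polyList,
    mapPart_eq_some (k := fun i => code ((P * Q).coeff i)), Part.map_some]
  · congr 1
    refine pack_polyList fun i hi => coeff_eq_zero_of_natDegree_lt ?_
    have := natDegree_mul_le (p := P) (q := Q)
    omega
  · intro k _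
    have hs := foldlM_map_eq_some (c := code) (d := id) (l := List.range (k + 1))
      (h := fun s i => (mulA (envOf code e q).1
        ((polyList code P (P.natDegree + 1)).getD i (envOf code e q).z)
        ((polyList code Q (Q.natDegree + 1)).getD (k - i) (envOf code e q).z)).bind
          fun m => addA (envOf code e q).1 s m)
      (k := fun s i => s + P.coeff i * Q.coeff (k - i)) (fun s i _ => by
        rw [envOf, Env.z, getD_polyList coeff_eq_zero_of_le, getD_polyList coeff_eq_zero_of_le,
          mulA_eq h, Part.bind_some, addA_eq h]
        rfl) 0
    rw [List.map_id] at hs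
    refine hs.trans ?_
    rw [coeff_mul, Finset.Nat.sum_antidiagonal_eq_sum_range_succ fun i j => P.coeff i * Q.coeff j]
    have hsum : ∀ m, (List.range m).foldl (fun s i => s + P.coeff i * Q.coeff (k - i)) 0 =
        ∑ i ∈ Finset.range m, P.coeff i * Q.coeff (k - i) := by
      intro m
      induction m with
      | zero => rfl
      | succ m ih => rw [List.range_succ, List.foldl_append, ih, Finset.sum_range_succ]; rfl
    rw [hsum]

theorem exists_closeStep_eq (K : List A) : ∃ K' : List A,
    closeStep (envOf code e q) (K.map code) = Part.some (K'.map code) ∧ (∀ a ∈ K, a ∈ K') ∧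
      (∀ a ∈ K, ∀ b ∈ K, a + b ∈ K' ∧ a * b ∈ K') ∧
      ∀ a ∈ K, a ≠ 0 → ∀ b, b ∣ a → b ∈ K' := by
  choose D hD hDm using exists_divsA_eq h (q := q)
  let p : List (A × A) := K.flatMap fun a => K.map fun b => (a, b)
  have hp : pairs (K.map code) = p.map fun x => (code x.1, code x.2) := by
    simp [pairs, p, List.map_flatMap, List.flatMap_map, Function.comp_def]
  have hpm : ∀ a b, (a, b) ∈ p ↔ a ∈ K ∧ b ∈ K := by simp [p]
  refine ⟨K ++ (p.map (fun x => x.1 + x.2) ++ (p.map (fun x => x.1 * x.2) ++ K.flatMap D)),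
    ?_, ?_, ?_, ?_⟩
  · rw [closeStep, hp, mapPart_map_eq_some (k := fun x : A × A => code (x.1 + x.2))
      fun x _ => addA_eq h _ _, mapPart_map_eq_some (k := fun x : A × A => code (x.1 * x.2))
      fun x _ => mulA_eq h _ _, mapPart_map_eq_some (k := fun a => (D a).map code) fun x _ => hD x]
    simp [List.flatMap_def, Function.comp_def]
  · intro a ha; simp [ha]
  · intro a ha b hb
    constructor
    · exact List.mem_append_right _ (List.mem_append_left _
        (List.mem_map.2 ⟨(a, b), (hpm a b).2 ⟨ha, hb⟩, rfl⟩))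
    · exact List.mem_append_right _ (List.mem_append_right _ (List.mem_append_left _
        (List.mem_map.2 ⟨(a, b), (hpm a b).2 ⟨ha, hb⟩, rfl⟩)))
  · intro a ha h0 b hb
    exact List.mem_append_right _ (List.mem_append_right _ (List.mem_append_right _
      (List.mem_flatMap.2 ⟨a, ha, (hDm a b).2 ⟨h0, hb⟩⟩)))

theorem exists_closeIter_eq (K : List A) (n : ℕ) : ∃ K' : List A,
    closeIter (envOf code e q) (K.map code) n = Part.some (K'.map code) ∧
      ∀ a ∈ Reach {a | a ∈ K} n, a ∈ K' := by
  induction n with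
  | zero => exact ⟨K, rfl, fun a ha => ha⟩
  | succ n ih =>
    obtain ⟨L, hL, hLm⟩ := ih
    obtain ⟨L', hL', h1, h2, h3⟩ := exists_closeStep_eq h (q := q) L
    refine ⟨L', ?_, ?_⟩
    · change (closeIter (envOf code e q) (K.map code) n).bind _ = _
      rw [hL, Part.bind_some, hL']
    · rintro a (ha | ⟨b, hb, c, hc, rfl | rfl⟩ | ⟨b, hb, h0, hab⟩)
      · exact h1 a (hLm a ha)
      · exact (h2 b (hLm b hb) c (hLm c hc)).1
      · exact (h2 b (hLm b hb) c (hLm c hc)).2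
      · exact h3 b (hLm b hb) h0 a hab

open scoped Classical in
theorem tryDivisor_eq (n a b : ℕ) (s : List ℕ) :
    tryDivisor (envOf code e q) n a b s = Part.some (if ∃ P Q : A[X], q ∣ P.coeff 1 ∧
      q ∣ Q.coeff 1 ∧ codeP code P = a ∧ codeP code Q = b ∧ codeP code (P * Q) = n
      then s ++ [a] else s) := by
  rw [tryDivisor, memB_eq h, memB_eq h, Part.bind_some, Part.bind_some]
  by_cases ha : ∃ P : A[X], q ∣ P.coeff 1 ∧ codeP code P = a
  · by_cases hb : ∃ P : A[X], q ∣ P.coeff 1 ∧ codeP code P = b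
    · rw [decide_eq_true ha, decide_eq_true hb]
      obtain ⟨P, hP, rfl⟩ := ha
      obtain ⟨Q, hQ, rfl⟩ := hb
      simp only [Bool.and_self, cond_true, mulB_eq h, Part.map_some, Bool.cond_decide]
      congr 1
      refine if_congr ⟨fun hn => ⟨P, Q, hP, hQ, rfl, rfl, hn⟩, ?_⟩ rfl rfl
      rintro ⟨P', Q', -, -, h1, h2, h3⟩
      rwa [codeP_injective h1, codeP_injective h2] at h3
    · rw [decide_eq_false hb, Bool.and_false, cond_false, if_neg]
      rintro ⟨P, Q, -, hQ, -, hb', -⟩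
      exact hb ⟨Q, hQ, hb'⟩
  · rw [decide_eq_false ha, Bool.false_and, cond_false, if_neg]
    rintro ⟨P, Q, hP, -, ha', -, -⟩
    exact ha ⟨P, hP, ha'⟩

/-- The candidates for divisors include all divisors. -/
theorem exists_divNonconst_eq (hq : Prime q) {P : A[X]} (hP : P ≠ 0) : ∃ out : List ℕ,
    divNonconst (envOf code e q) (codeP code P) = Part.some (listIndex out) ∧
      ∀ n, n ∈ out ↔
        ∃ Q R : A[X], q ∣ Q.coeff 1 ∧ q ∣ R.coeff 1 ∧ Q * R = P ∧ codeP code Q = n := by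
  classical
  set N := P.natDegree + 1 with hN
  let K : List A := q :: (List.range N).map fun i => P.coeff i
  have hK : K.map code = code q :: polyList code P N := by simp [K, polyList]
  obtain ⟨L, hL, hLm⟩ := exists_closeIter_eq h (q := q) K (10 * N + 3)
  rw [hK] at hL
  have hcand : ∀ Q : A[X], Q ∣ P → codeP code Q ∈
      (tuples (L.map code) N).map fun t => pack (code 0) t := by
    intro Q hQ
    have hd : Q.natDegree < N := Nat.lt_succ_of_le (natDegree_le_of_dvd hQ hP)
    refine List.mem_map.2 ⟨polyList code Q N, mem_tuples.2 ⟨length_polyList, ?_⟩,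
      pack_polyList fun i hi => coeff_eq_zero_of_natDegree_lt (hd.trans_le hi)⟩
    intro n hn
    obtain ⟨i, -, rfl⟩ := List.mem_map.1 hn
    refine List.mem_map_of_mem (hLm _ (coeff_mem_reach_of_dvd hq hP hQ (by omega) ?_ ?_ i))
    · simp [K]
    · intro j hj
      exact List.mem_cons_of_mem _
        (List.mem_map.2 ⟨j, List.mem_range.2 (Nat.lt_succ_of_le hj), rfl⟩)
  let p : ℕ × ℕ → Prop := fun x => ∃ Q R : A[X], q ∣ Q.coeff 1 ∧ q ∣ R.coeff 1 ∧
    codeP code Q = x.1 ∧ codeP code R = x.2 ∧ codeP code (Q * R) = codeP code P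
  refine ⟨(candidates (code 0) (L.map code) N).foldl (fun s x => if p x then s ++ [x.1] else s) [],
    ?_, fun n => mem_foldl_append_iff.trans ⟨?_, ?_⟩⟩
  · rw [divNonconst, unpack_codeP, length_polyList]
    refine (congrArg (Part.bind · _) hL).trans ?_
    rw [Part.bind_some]
    refine (congrArg (Part.map listIndex) (foldlM_eq_some
      (fun s x _ => tryDivisor_eq h _ x.1 x.2 s) [])).trans ?_
    rw [Part.map_some]
    rfl
  · rintro ⟨x, _, ⟨Q, R, hQ, hR, h1, _, h3⟩, hx⟩
    exact ⟨Q, R, hQ, hR, codeP_injective h3, h1.trans hx⟩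
  · rintro ⟨Q, R, hQ, hR, h1, h2⟩
    exact ⟨(codeP code Q, codeP code R), mem_pairs.2
      ⟨hcand Q ⟨R, h1.symm⟩, hcand R ⟨Q, (mul_comm R Q ▸ h1).symm⟩⟩,
      ⟨Q, R, hQ, hR, rfl, rfl, by rw [h1]⟩, h2⟩

theorem formB_eq {l : List A} {P : A[X]}
    (hP : ∀ i, P.coeff i = if i = 1 then q * l.getD i 0 else l.getD i 0) :
    formB (envOf code e q) (l.map code) = Part.some (codeP code P) := by
  have hl : ∀ i, (l.map code).getD i (code 0) = code (l.getD i 0) := by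
    intro i
    rw [List.getD_eq_getElem?_getD, List.getD_eq_getElem?_getD, List.getElem?_map,
      Option.getD_map]
  rw [formB, mapPart_eq_some (k := fun i => code (P.coeff i)), Part.map_some, List.length_map]
  · congr 1
    refine pack_polyList fun i hi => ?_
    rw [hP, List.getD_eq_getElem?_getD, List.getElem?_eq_none hi]
    simp
  · intro i _
    rw [envOf, Env.z, Env.q, hl, hP]
    by_cases hi : i = 1
    · simp [hi, mulA_eq h]
    · simp [hi]

end

/-! ### Indices for `B` -/

section

/-- Indices for the programs for `B` are computed from indices for `A` and the code of `q`. -/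
theorem exists_index_transform : ∃ T : SCFFDIndex × ℕ → SCFFDIndex × Code, Computable T ∧
    ∀ e m z, findZero e = Part.some z →
      (∀ n, (T (e, m)).1.1.1.eval n = (memB (e, m, z) n).map fun b => cond b 1 0) ∧
      (∀ a b, (T (e, m)).1.1.2.1.eval (Nat.pair a b) = addB (e, m, z) a b) ∧
      (∀ a b, (T (e, m)).1.1.2.2.eval (Nat.pair a b) = mulB (e, m, z) a b) ∧
      (∀ n, (T (e, m)).1.2.eval n = divB (e, m, z) n) ∧
      ∀ l : List ℕ, (T (e, m)).2.eval (Encodable.encode l) = formB (e, m, z) l := by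
  have hz : Partrec fun x : (SCFFDIndex × ℕ) × ℕ => findZero x.1.1 :=
    partrec_findZero (Computable.fst.comp .fst)
  have hE : Computable fun x : ((SCFFDIndex × ℕ) × ℕ) × ℕ => ((x.1.1.1, x.1.1.2, x.2) : Env) :=
    (Computable.fst.comp (Computable.fst.comp .fst)).pair
      ((Computable.snd.comp (Computable.fst.comp .fst)).pair .snd)
  have hn : Computable fun x : ((SCFFDIndex × ℕ) × ℕ) × ℕ => x.1.2 := Computable.snd.comp .fst
  have hn1 := Computable.fst.comp (Computable.unpair.comp hn)
  have hn2 := Computable.snd.comp (Computable.unpair.comp hn)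
  obtain ⟨t₁, ht₁, h₁⟩ := exists_computable_index
    (Φ := fun (x : SCFFDIndex × ℕ) n => (findZero x.1).bind fun z =>
      (memB (x.1, x.2, z) n).map fun b => cond b 1 0)
    (Partrec.bind hz (Partrec.map (partrec_memB hE hn)
      (Computable.cond .snd (.const 1) (.const 0))))
  obtain ⟨t₂, ht₂, h₂⟩ := exists_computable_index
    (Φ := fun (x : SCFFDIndex × ℕ) n => (findZero x.1).bind fun z =>
      addB (x.1, x.2, z) n.unpair.1 n.unpair.2) (Partrec.bind hz (partrec_addB hE hn1 hn2))
  obtain ⟨t₃, ht₃, h₃⟩ := exists_computable_index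
    (Φ := fun (x : SCFFDIndex × ℕ) n => (findZero x.1).bind fun z =>
      mulB (x.1, x.2, z) n.unpair.1 n.unpair.2) (Partrec.bind hz (partrec_mulB hE hn1 hn2))
  obtain ⟨t₄, ht₄, h₄⟩ := exists_computable_index
    (Φ := fun (x : SCFFDIndex × ℕ) n => (findZero x.1).bind fun z => divB (x.1, x.2, z) n)
    (Partrec.bind hz (partrec_divB hE hn))
  obtain ⟨t₅, ht₅, h₅⟩ := exists_computable_index
    (Φ := fun (x : SCFFDIndex × ℕ) n => (findZero x.1).bind fun z =>
      formB (x.1, x.2, z) ((Encodable.decode n).getD []))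
    (Partrec.bind hz (partrec_formB hE
      ((Primrec.option_getD.to_comp.comp .decode (.const [])).comp hn)))
  refine ⟨fun x => (((t₁ x, t₂ x, t₃ x), t₄ x), t₅ x),
    ((ht₁.pair (ht₂.pair ht₃)).pair ht₄).pair ht₅, fun e m z h => ?_⟩
  simp [h₁, h₂, h₃, h₄, h₅, h]

end

section

variable {A : Type u} [CommRing A] [IsDomain A] {F : Type v} [Field F] [Algebra A F]
  [IsFractionRing A F] {q : A} {hq : Prime q}

/-- The coding of `B`: an element `f(x)` gets the code of the polynomial `f(q x)`. -/
noncomputable def codeB (code : A ↪ ℕ) : primeDestroyer F hq ↪ ℕ :=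
  ⟨fun f => codeP code (toPoly F hq f), fun _ _ h => toPoly_injective (codeP_injective h)⟩

variable {code : A ↪ ℕ}

theorem codeB_apply (f : primeDestroyer F hq) : codeB code f = codeP code (toPoly F hq f) := rfl

theorem codeB_incl (a : A) : codeB code (primeDestroyerIncl F hq a) = 2 * code a := by
  rw [codeB_apply, toPoly_incl, codeP_C]

theorem exists_incl_eq_of_codeB {f : primeDestroyer F hq} {n : ℕ} (h : 2 * n = codeB code f) :
    ∃ a, primeDestroyerIncl F hq a = f := by
  rw [codeB_apply, codeP] at h
  split_ifs at h with h0
  · exact ⟨_, (natDegree_toPoly_eq_zero h0).symm⟩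
  · omega

theorem mem_range_codeB {n : ℕ} : n ∈ Set.range (codeB (F := F) (hq := hq) code) ↔
    ∃ P : A[X], q ∣ P.coeff 1 ∧ codeP code P = n := by
  constructor
  · rintro ⟨f, rfl⟩
    exact ⟨_, dvd_coeff_toPoly F hq f, rfl⟩
  · rintro ⟨P, hP, rfl⟩
    obtain ⟨f, rfl⟩ := exists_toPoly_eq (F := F) (hq := hq) hP
    exact ⟨f, rfl⟩

variable {e : SCFFDIndex}

theorem divB_incl (a : A) :
    divB (envOf code e q) (codeB code (primeDestroyerIncl F hq a)) =
      (e.2.eval (code a)).map (canonicalRelabel fun n => 2 * n) := by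
  rw [codeB_incl, divB]
  simp [envOf]

/-- The divisor function of `B` is correct: on constants since it copies that of `A`, elsewhere by
Kronecker's method. -/
theorem exists_divB_eq (f : primeDestroyer F hq) (hf : f ≠ 0) (h : IsSCFFD code e) :
    ∃ S : Finset (primeDestroyer F hq), (∀ g, g ∈ S ↔ g ∣ f) ∧
      divB (envOf code e q) (codeB code f) = Part.some (canonicalIndex (S.map (codeB code))) := by
  classical
  by_cases h0 : (toPoly F hq f).natDegree = 0
  · obtain ⟨a, rfl⟩ : ∃ a, primeDestroyerIncl F hq a = f := ⟨_, (natDegree_toPoly_eq_zero h0).symm⟩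
    have ha : a ≠ 0 := by rintro rfl; exact hf (map_zero _)
    obtain ⟨S, hS, he⟩ := h.eval_divisors a ha
    refine ⟨S.image (primeDestroyerIncl F hq), fun g => ?_, ?_⟩
    · rw [dvd_incl_iff ha, Finset.mem_image]
      simp only [hS]
    · rw [divB_incl, he, Part.map_some, canonicalRelabel, canonicalSet_canonicalIndex]
      congr 2
      ext n
      simp [codeB_incl]
  · obtain ⟨out, ho, hout⟩ := exists_divNonconst_eq h hq (toPoly_ne_zero hf)
    have hmem : ∀ n, n ∈ out ↔ ∃ g : primeDestroyer F hq, g ∣ f ∧ codeB code g = n := by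
      intro n
      rw [hout]
      constructor
      · rintro ⟨Q, R, hQ, hR, hQR, hn⟩
        obtain ⟨g, rfl⟩ := exists_toPoly_eq (F := F) (hq := hq) hQ
        obtain ⟨k, rfl⟩ := exists_toPoly_eq (F := F) (hq := hq) hR
        exact ⟨g, (dvd_iff_toPoly g f).2 ⟨k, hQR⟩, hn⟩
      · rintro ⟨g, hg, hn⟩
        obtain ⟨k, hk⟩ := (dvd_iff_toPoly g f).1 hg
        exact ⟨_, _, dvd_coeff_toPoly F hq g, dvd_coeff_toPoly F hq k, hk, hn⟩
    refine ⟨out.toFinset.preimage (codeB code) (codeB code).injective.injOn, fun g => ?_, ?_⟩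
    · rw [Finset.mem_preimage, List.mem_toFinset, hmem]
      exact ⟨fun ⟨k, hk, hkg⟩ => (codeB code).injective hkg ▸ hk, fun hg => ⟨g, hg, rfl⟩⟩
    · have hodd : ¬ codeB code f % 2 = 0 := by rw [codeB_apply, codeP, if_neg h0]; omega
      rw [divB, decide_eq_false hodd, cond_false]
      refine ho.trans ?_
      rw [listIndex_eq]
      congr 2
      ext n
      simp only [List.mem_toFinset, Finset.mem_map, Finset.mem_preimage, hmem]
      constructor
      · rintro ⟨g, hg, rfl⟩
        exact ⟨g, ⟨g, hg, rfl⟩, rfl⟩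
      · rintro ⟨g, ⟨k, hk, hkg⟩, rfl⟩
        exact ⟨k, hk, hkg⟩

end

theorem theoremt :
    -- a computable renaming `ι` of the natural numbers (to make room for the new elements),
    -- and an algorithm `T` turning indices for `A` and the code of `q` into indices for `B`
    -- and for the formation of elements of `B` from their coefficients
    ∃ (ι : ℕ → ℕ) (T : SCFFDIndex × ℕ → SCFFDIndex × Code),
      Computable ι ∧ Function.Injective ι ∧ ComputablePred (fun n => n ∈ Set.range ι) ∧
      Computable T ∧
      ∀ (A : Type u) [CommRing A] [IsDomain A] (F : Type v) [Field F] [Algebra A F]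
        [IsFractionRing A F] (code : A ↪ ℕ) (e : SCFFDIndex) (_ : IsSCFFD code e)
        (q : A) (hq : Prime q),
        -- the divisors of a nonzero element of `A` are the same in `A` and in `B`
        (∀ a : A, a ≠ 0 → {f : primeDestroyer F hq | f ∣ primeDestroyerIncl F hq a} =
          primeDestroyerIncl F hq '' {b : A | b ∣ a}) ∧
        -- `B` is an SCFFD, uniformly, and its divisor function extends that of `A`
        (∃ codeB : primeDestroyer F hq ↪ ℕ,
          IsSCFFD codeB (T (e, code q)).1 ∧
          (∀ a : A, codeB (primeDestroyerIncl F hq a) = ι (code a)) ∧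
          (∀ f : primeDestroyer F hq, codeB f ∈ Set.range ι →
            f ∈ Set.range (primeDestroyerIncl F hq)) ∧
          (∀ (l : List A) (f : primeDestroyer F hq),
            (∀ i, (f : F[X]).coeff i = denomFrac F q i (l.getD i 0)) →
            (T (e, code q)).2.eval (Encodable.encode (l.map code)) = Part.some (codeB f)) ∧
          (∀ a : A, (T (e, code q)).1.2.eval (codeB (primeDestroyerIncl F hq a)) =
            (e.2.eval (code a)).map (canonicalRelabel ι))) ∧
        -- the units of `B` are those of `A`
        ({f : primeDestroyer F hq | IsUnit f} = primeDestroyerIncl F hq '' {a : A | IsUnit a}) ∧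
        -- irreducibles stay irreducible
        (∀ p : A, Irreducible p → Irreducible (primeDestroyerIncl F hq p)) ∧
        -- irreducibles that are not associates stay non-associates
        (∀ p₁ p₂ : A, Irreducible p₁ → Irreducible p₂ → ¬ Associated p₁ p₂ →
          ¬ Associated (primeDestroyerIncl F hq p₁) (primeDestroyerIncl F hq p₂)) ∧
        -- `q` is no longer prime
        ¬ Prime (primeDestroyerIncl F hq q) ∧
        -- the other primes stay prime
        (∀ p : A, Prime p → ¬ Associated p q → Prime (primeDestroyerIncl F hq p)) := by
  obtain ⟨T, hT, hTe⟩ := exists_index_transform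
  refine ⟨fun n => 2 * n, T, Primrec.nat_double.to_comp, fun a b hab => by simpa using hab, ?_,
    hT, ?_⟩
  · have hp : PrimrecPred fun n : ℕ => n % 2 = 0 :=
      Primrec.eq.comp (Primrec.nat_mod.comp .id (.const 2)) (.const 0)
    refine (hp.of_eq fun n => ?_).computablePred
    rw [Set.mem_range]
    exact ⟨fun hn => ⟨n / 2, by omega⟩, fun ⟨m, hm⟩ => by simp [← hm]⟩
  intro A _ _ F _ _ _ code e h q hq
  obtain ⟨h₁, h₂, h₃, h₄, h₅⟩ := hTe e (code q) (code 0) (findZero_eq h)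
  classical
  refine ⟨fun a ha => Set.ext fun f => dvd_incl_iff ha f, ⟨codeB code, ⟨⟨?_, ?_, ?_, ?_⟩, ?_⟩,
    codeB_incl, ?_, ?_, ?_⟩, Set.ext isUnit_iff_incl, fun p => irreducible_incl,
    fun p₁ p₂ _ _ hp hp' => hp (associated_incl hp'), not_prime_incl, fun p => prime_incl⟩
  · intro n hn
    rw [h₁]
    refine (congrArg (Part.map _) (memB_eq h (q := q) n)).trans ?_
    rw [decide_eq_true (mem_range_codeB.1 hn), Part.map_some, cond_true]
  · intro n hn
    rw [h₁]
    refine (congrArg (Part.map _) (memB_eq h (q := q) n)).trans ?_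
    rw [decide_eq_false fun hn' => hn (mem_range_codeB.2 hn'), Part.map_some, cond_false]
  · intro f g
    rw [h₂, codeB_apply, codeB_apply, codeB_apply, toPoly_add]
    exact addB_eq h _ _
  · intro f g
    rw [h₃, codeB_apply, codeB_apply, codeB_apply, toPoly_mul]
    exact mulB_eq h _ _
  · intro f hf
    rw [h₄]
    exact exists_divB_eq f hf h
  · rintro f ⟨n, hn⟩
    exact exists_incl_eq_of_codeB hn
  · intro l f hf
    rw [h₅]
    -- the polynomial `f(q x)`
    have hP : ∀ i, (toPoly F hq f).coeff i = if i = 1 then q * l.getD i 0 else l.getD i 0 := by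
      obtain ⟨P, hP⟩ := exists_coeff_eq (fun i => if i = 1 then q * l.getD i 0 else l.getD i 0)
        (N := l.length) (fun i hi => by simp [List.getD_eq_getElem?_getD, hi])
      rw [toPoly_eq (descale_eq_of_coeff F hf hP hq)]
      exact hP
    exact formB_eq h hP
  · intro a
    rw [h₄]
    exact divB_incl a
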